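/- Let $K,L,I,J$ be finite non-empty sets, $g:K\times L\times I\times J\to[-1,1]$, and let $M$, $N$ be stochastic matrices on $K$, $L$ for which all states are recurrent and aperiodic. Let $B=\lim_t M^t$ and $C=\lim_t N^t$, and let $P^*\subset\Delta(K)$, $Q^*\subset\Delta(L)$ be the sets of invariant probabilities of $M$ and $N$. For $p^*\in P^*$, $q^*\in Q^*$ put $B^{-1}(p^*)=\{p\in\Delta(K): pB=p^*\}$ and $C^{-1}(q^*)=\{q\in\Delta(L): qC=q^*\}$. The Markov chains $(k_t)_{t\ge1}$ (initial law $p\in\Delta(K)$, transition matrix $M$) and $(l_t)_{t\ge1}$ (initial law $q\in\Delta(L)$, transition matrix $N$) are independent. At each stage $t$, Player 1 observes $k_t$, Player 2 observes $l_t$, they simultaneously choose $i_t\in I$, $j_t\in J$, and $(i_t,j_t)$ is publicly announced. A behavior strategy $\sigma$ of Player 1 (resp. $\tau$ of Player 2) consists of maps $\sigma_t:(I\times J)^{t-1}\times K^t\to\Delta(I)$ (resp. $\tau_t:(I\times J)^{t-1}\times L^t\to\Delta(J)$), $t\ge1$. Let $\mathbb P_{p,q,\sigma,\tau}$ be the induced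 law of the play and $\gamma_T^{p,q}(\sigma,\tau)=\mathbb E_{p,q,\sigma,\tau}\big[\frac1T\sum_{t=1}^T g(k_t,l_t,i_t,j_t)\big]$. A strategy $\sigma$ is non-revealing at $p$ if for all $q\in\Delta(L)$, all $\tau$, all $T\ge0$ and all $h_T\in(I\times J)^T$ with $\mathbb P_{p,q,\sigma,\tau}(h_T)>0$, the conditional law $p_T$ of $k_{T+1}$ given $h_T$ satisfies $p_TB=pB$; let $\hat\Sigma(p)$ be the set of these strategies. The set $\hat{\mathcal T}(q)$ of strategies of Player 2 that are non-revealing at $q$ is defined symmetrically, with $C$. The $T$-stage non-revealing game at $(p,q)$ is the zero-sum game $(\hat\Sigma(p),\hat{\mathcal T}(q),\gamma_T^{p,q})$. For $x\in\Delta(I)^K$ let $x(p)(i)=\sum_kp^kx^k(i)$ and, if $x(p)(i)>0$, $\vec p(x,i)=\big(p^kx^k(i)/x(p)(i)\big)_{k\in K}$ (arbitrary otherwise). Let $NR(p)$ be the set of $x\in\Delta(I)^K$ such that $\vec p(x,i)B=pB$ for every $i$ with $x(p)(i)>0$. Define $y(q)(j)$, $\vec q(y,j)$ and $NR(q)\subset\Delta(J)^L$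 in the same way, with $C$ in place of $B$. Let $G(p,q,x,y)=\sum_{k,l,i,j}p^kq^lx^k(i)y^l(j)g(k,l,i,j)$. Proposition. (1) For all $T\ge1$ and $(p,q)\in\Delta(K)\times\Delta(L)$, the $T$-stage non-revealing game at $(p,q)$ has a value $$\hat v_T(p,q)=\max_{\sigma\in\hat\Sigma(p)}\min_{\tau\in\hat{\mathcal T}(q)}\gamma_T^{p,q}(\sigma,\tau)=\min_{\tau\in\hat{\mathcal T}(q)}\max_{\sigma\in\hat\Sigma(p)}\gamma_T^{p,q}(\sigma,\tau),$$ all maxima and minima being attained. (2) For all $T\ge1$, $q\in\Delta(L)$ and $p^*\in P^*$, the function $p\mapsto\hat v_T(p,q)$ is concave on $B^{-1}(p^*)$; for all $T\ge1$, $p\in\Delta(K)$ and $q^*\in Q^*$, the function $q\mapsto\hat v_T(p,q)$ is convex on $C^{-1}(q^*)$. (3) For all $T\ge0$ and $(p,q)\in\Delta(K)\times\Delta(L)$ (with $T\hat v_T$ read as $0$ when $T=0$), $$(T+1)\hat v_{T+1}(p,q)=\max_{x\in NR(p)}\min_{y\in NR(q)}\Big(G(p,q,x,y)+T\sum_{i\in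 I,\,j\in J}x(p)(i)\,y(q)(j)\,\hat v_T(\vec p(x,i)M,\vec q(y,j)N)\Big)$$ $$=\min_{y\in NR(q)}\max_{x\in NR(p)}\Big(G(p,q,x,y)+T\sum_{i\in I,\,j\in J}x(p)(i)\,y(q)(j)\,\hat v_T(\vec p(x,i)M,\vec q(y,j)N)\Big),$$ all maxima and minima being attained. -/

import Mathlib

open Filter Topology
open scoped BigOperators Matrix

namespace MarkovGames

/-! ### Finite Markov chains -/

/-- Every state is recurrent: in a finite chain, a state `s` is recurrent if and only if it
can be reached back from every state that it leads to. -/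
def IsRecurrent {S : Type*} [Fintype S] [DecidableEq S] (M : Matrix S S ℝ) : Prop :=
  ∀ s s' : S, (∃ n : ℕ, 0 < (M ^ n) s s') → ∃ n : ℕ, 0 < (M ^ n) s' s

/-- Every state has period one: the greatest common divisor of the set of all `n ≥ 1` with
`0 < (M ^ n) s s` is `1`. -/
def IsAperiodic {S : Type*} [Fintype S] [DecidableEq S] (M : Matrix S S ℝ) : Prop :=
  ∀ s : S, ∀ d : ℕ, (∀ n : ℕ, 1 ≤ n → 0 < (M ^ n) s s → d ∣ n) → d = 1

/-- The limit of `M ^ t` as `t` tends to infinity. -/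
noncomputable def limitMatrix {S : Type*} [Fintype S] [DecidableEq S] (M : Matrix S S ℝ) :
    Matrix S S ℝ :=
  limUnder atTop (fun t : ℕ => M ^ t)

/-- The set of invariant probabilities of `M`. -/
def invariantProbs {S : Type*} [Fintype S] (M : Matrix S S ℝ) : Set (S → ℝ) :=
  {p | p ∈ stdSimplex ℝ S ∧ p ᵥ* M = p}

/-- The probabilities `p` such that `p B = r`. -/
def fiber {S : Type*} [Fintype S] (B : Matrix S S ℝ) (r : S → ℝ) : Set (S → ℝ) :=
  {p | p ∈ stdSimplex ℝ S ∧ p ᵥ* B = r}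

/-- The probability that the first `t` states of the Markov chain with initial law `p` and
transition matrix `M` are `s 0, …, s (t - 1)`. -/
def chainProb {S : Type*} (p : S → ℝ) (M : Matrix S S ℝ) : {t : ℕ} → (Fin t → S) → ℝ
  | 0, _ => 1
  | t + 1, s => p (s 0) * ∏ r : Fin t, M (s r.castSucc) (s r.succ)

/-! ### One-stage actions depending on the state -/

/-- `x(p)(a) = ∑ₛ pˢ xˢ(a)`: the probability that action `a` is played when the state has law
`p` and the mixed action `x s` is played in state `s`. -/
def actionProb {S A : Type*} [Fintype S] (p : S → ℝ) (x : S → A → ℝ) (a : A) : ℝ :=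
  ∑ s, p s * x s a

/-- The conditional law of the state given that `a` was played (only meaningful when `a` has
positive probability; the zero vector otherwise). -/
noncomputable def bayes {S A : Type*} [Fintype S] (p : S → ℝ) (x : S → A → ℝ) (a : A) :
    S → ℝ :=
  fun s => p s * x s a / actionProb p x a

/-- The one-stage actions `x ∈ Δ(A)^S` that are non-revealing at `p` with respect to `B`. -/
def NR {S A : Type*} [Fintype S] [Fintype A] (B : Matrix S S ℝ) (p : S → ℝ) :
    Set (S → A → ℝ) :=
  {x | (∀ s, x s ∈ stdSimplex ℝ A) ∧
    ∀ a, 0 < actionProb p x a → bayes p x a ᵥ* B = p ᵥ* B}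

/-! ### Max-min and min-max with attained optima -/

/-- `v = max_{x ∈ X} min_{y ∈ Y} f x y`, all the optima being attained. -/
def IsMaxMin {α β : Type*} (X : Set α) (Y : Set β) (f : α → β → ℝ) (v : ℝ) : Prop :=
  ∃ m : α → ℝ, (∀ x ∈ X, IsLeast ((fun y => f x y) '' Y) (m x)) ∧ IsGreatest (m '' X) v

/-- `v = min_{y ∈ Y} max_{x ∈ X} f x y`, all the optima being attained. -/
def IsMinMax {α β : Type*} (X : Set α) (Y : Set β) (f : α → β → ℝ) (v : ℝ) : Prop :=
  ∃ m : β → ℝ, (∀ y ∈ Y, IsGreatest ((fun x => f x y) '' X) (m y)) ∧ IsLeast (m '' Y) v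

/-! ### The game -/

/-- A behavior strategy of a player with state space `S` and action set `A`, where `H` is the
set of pairs of actions: for each number `t` of past stages, it maps the past pairs of actions and
the states of stages `1, …, t + 1` to a mixed action. -/
abbrev Strategy (H S A : Type*) [Fintype A] : Type _ :=
  (t : ℕ) → (Fin t → H) → (Fin (t + 1) → S) → stdSimplex ℝ A

end MarkovGames

open MarkovGames

/-- A zero-sum Markov chain game with lack of information on both sides. -/
structure MarkovGame (K L I J : Type*) [Fintype K] [Fintype L] [DecidableEq K]
    [DecidableEq L] where
  /-- the payoff of the first player -/
  g : K → L → I → J → ℝ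
  /-- the transition matrix on `K` -/
  M : Matrix K K ℝ
  /-- the transition matrix on `L` -/
  N : Matrix L L ℝ
  g_mem : ∀ k l i j, g k l i j ∈ Set.Icc (-1 : ℝ) 1
  M_mem : M ∈ Matrix.rowStochastic ℝ K
  N_mem : N ∈ Matrix.rowStochastic ℝ L

namespace MarkovGame

variable {K L I J : Type*} [Fintype K] [Fintype L] [Fintype I] [Fintype J]
  [DecidableEq K] [DecidableEq L] [DecidableEq I] [DecidableEq J]

/-- The limit of `M ^ t`. -/
noncomputable def B (G : MarkovGame K L I J) : Matrix K K ℝ := limitMatrix G.M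

/-- The limit of `N ^ t`. -/
noncomputable def C (G : MarkovGame K L I J) : Matrix L L ℝ := limitMatrix G.N

/-- The states in `K` along a finite play. -/
def kStates {t : ℕ} (ω : Fin t → K × L × I × J) : Fin t → K := fun s => (ω s).1

/-- The states in `L` along a finite play. -/
def lStates {t : ℕ} (ω : Fin t → K × L × I × J) : Fin t → L := fun s => (ω s).2.1

/-- The history of actions of a finite play. -/
def actions {t : ℕ} (ω : Fin t → K × L × I × J) : Fin t → I × J := fun s => (ω s).2.2

/-- The probability, when the initial laws are `p`, `q` and `σ`, `τ` are played, that the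
sequence of states and actions of the first `t` stages is `ω`. The index `s : Fin t` stands for
stage `s + 1`. -/
noncomputable def playProb (G : MarkovGame K L I J) (p : K → ℝ) (q : L → ℝ)
    (σ : Strategy (I × J) K I) (τ : Strategy (I × J) L J) {t : ℕ}
    (ω : Fin t → K × L × I × J) : ℝ :=
  chainProb p G.M (kStates ω) * chainProb q G.N (lStates ω) *
    ∏ s : Fin t,
      ((σ s (Fin.take s s.isLt.le (actions ω)) (Fin.take (s + 1) s.isLt (kStates ω))).1
          (actions ω s).1 *
       (τ s (Fin.take s s.isLt.le (actions ω)) (Fin.take (s + 1) s.isLt (lStates ω))).1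
          (actions ω s).2)

/-- The expected average payoff of the first `T` stages. -/
noncomputable def payoff (G : MarkovGame K L I J) (T : ℕ) (p : K → ℝ) (q : L → ℝ)
    (σ : Strategy (I × J) K I) (τ : Strategy (I × J) L J) : ℝ :=
  ∑ ω : Fin T → K × L × I × J, G.playProb p q σ τ ω *
    ((1 / (T : ℝ)) * ∑ s, G.g (ω s).1 (ω s).2.1 (ω s).2.2.1 (ω s).2.2.2)

/-- The probability of a history of actions. -/
noncomputable def historyProb (G : MarkovGame K L I J) (p : K → ℝ) (q : L → ℝ)
    (σ : Strategy (I × J) K I) (τ : Strategy (I × J) L J) {T : ℕ} (h : Fin T → I × J) : ℝ :=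
  ∑ ω : Fin T → K × L × I × J, if actions ω = h then G.playProb p q σ τ ω else 0

/-- The conditional law of the state in `K` of stage `T + 1` given the history `h` of actions of
the first `T` stages (meaningful when `h` has positive probability). -/
noncomputable def kBelief (G : MarkovGame K L I J) (p : K → ℝ) (q : L → ℝ)
    (σ : Strategy (I × J) K I) (τ : Strategy (I × J) L J) {T : ℕ} (h : Fin T → I × J) :
    K → ℝ := fun k =>
  (∑ ω : Fin (T + 1) → K × L × I × J,
    if actions (Fin.init ω) = h ∧ (ω (Fin.last T)).1 = k then G.playProb p q σ τ ω else 0) /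
    G.historyProb p q σ τ h

/-- The conditional law of the state in `L` of stage `T + 1` given the history `h` of actions of
the first `T` stages (meaningful when `h` has positive probability). -/
noncomputable def lBelief (G : MarkovGame K L I J) (p : K → ℝ) (q : L → ℝ)
    (σ : Strategy (I × J) K I) (τ : Strategy (I × J) L J) {T : ℕ} (h : Fin T → I × J) :
    L → ℝ := fun l =>
  (∑ ω : Fin (T + 1) → K × L × I × J,
    if actions (Fin.init ω) = h ∧ (ω (Fin.last T)).2.1 = l then G.playProb p q σ τ ω else 0) /
    G.historyProb p q σ τ h

/-- The non-revealing strategies of the first player at `p`: whatever `q` and `τ`, the process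
`T ↦ (belief on the state of stage T + 1) B` almost surely stays at its initial value `p B`. -/
def nonRevealing₁ (G : MarkovGame K L I J) (p : K → ℝ) : Set (Strategy (I × J) K I) :=
  {σ | ∀ q ∈ stdSimplex ℝ L, ∀ τ : Strategy (I × J) L J, ∀ (T : ℕ) (h : Fin T → I × J),
    0 < G.historyProb p q σ τ h → G.kBelief p q σ τ h ᵥ* G.B = p ᵥ* G.B}

/-- The non-revealing strategies of the second player at `q`. -/
def nonRevealing₂ (G : MarkovGame K L I J) (q : L → ℝ) : Set (Strategy (I × J) L J) :=
  {τ | ∀ p ∈ stdSimplex ℝ K, ∀ σ : Strategy (I × J) K I, ∀ (T : ℕ) (h : Fin T → I × J),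
    0 < G.historyProb p q σ τ h → G.lBelief p q σ τ h ᵥ* G.C = q ᵥ* G.C}

/-- The value of the `T`-stage non-revealing game at `(p, q)`. -/
noncomputable def nrValue (G : MarkovGame K L I J) (T : ℕ) (p : K → ℝ) (q : L → ℝ) : ℝ :=
  ⨆ σ : G.nonRevealing₁ p, ⨅ τ : G.nonRevealing₂ q, G.payoff T p q σ.1 τ.1

/-- The expected one-stage payoff. -/
def stagePayoff (G : MarkovGame K L I J) (p : K → ℝ) (q : L → ℝ) (x : K → I → ℝ)
    (y : L → J → ℝ) : ℝ :=
  ∑ k, ∑ l, ∑ i, ∑ j, p k * q l * x k i * y l j * G.g k l i j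

/-- The one-stage payoff plus `T` times the expected value of `f` at the beliefs on the next
states. -/
noncomputable def shapley (G : MarkovGame K L I J) (T : ℕ) (f : (K → ℝ) → (L → ℝ) → ℝ)
    (p : K → ℝ) (q : L → ℝ) (x : K → I → ℝ) (y : L → J → ℝ) : ℝ :=
  G.stagePayoff p q x y + (T : ℝ) * ∑ i, ∑ j, actionProb p x i * actionProb q y j *
    f (bayes p x i ᵥ* G.M) (bayes q y j ᵥ* G.N)

end MarkovGame

namespace MarkovGames

/-! ### Convergence of the powers of a recurrent aperiodic stochastic matrix -/

section Markov

variable {S : Type*} [Fintype S] [DecidableEq S] {M : Matrix S S ℝ}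

/-! Because the chains are independent and each player acts on his own state, the joint law of a
history and the current states factors into one term per player. `Side.bel` is such a factor, an
unnormalized belief. The opponent's factor cancels from the conditional law, so being non-revealing
constrains the player's own strategy alone: every `bel` must be sent by the limit matrix to its
total mass times `pB` (`Side.KeepsAt`). This condition is linear in the belief. The game arguments
use only one property of the limit, `M * B = B` (`mul_limitMatrix`): moving the chain one step does
not change the image under `B`.

Value: non-revealing strategies form a compact set on which the payoff is continuous. As in Kuhn's
theorem, a mixture of behavior strategies is realized by a behavior strategy (`Side.mix`), which is
again non-revealing by linearity. A minimax theorem for convex-like payoffs (`exists_saddle`) then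
applies.

Concavity: if `p₁` and `p₂` have the same image under `B`, mixing two strategies with initial
weights `a • p₁` and `b • p₂` gives a non-revealing strategy at `a • p₁ + b • p₂` with the averaged
payoff.

Recursion: a non-revealing strategy starts with an element of `NR`, and its continuation, averaged
over the first state, is non-revealing at the next belief. Conversely, such data assemble into a
non-revealing strategy. Hence the one-stage expression at `(x, y)` is the value of the longer game
with first actions fixed to `x` and `y` (`exists_stageValue_le`, `exists_le_stageValue`). Optimal
strategies of that game yield optimal `x` and `y`, without any continuity of the value function. -/

theorem pow_nonneg_of_rowStochastic (hM : M ∈ Matrix.rowStochastic ℝ S) (n : ℕ) (s u : S) :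
    0 ≤ (M ^ n) s u :=
  Matrix.nonneg_of_mem_rowStochastic (pow_mem hM n)

theorem mul_le_pow_add (hM : M ∈ Matrix.rowStochastic ℝ S) (m n : ℕ) (s u w : S) :
    (M ^ m) s u * (M ^ n) u w ≤ (M ^ (m + n)) s w := by
  rw [pow_add, Matrix.mul_apply]
  exact Finset.single_le_sum (f := fun u => (M ^ m) s u * (M ^ n) u w)
    (fun v _ => mul_nonneg (pow_nonneg_of_rowStochastic hM _ _ _)
      (pow_nonneg_of_rowStochastic hM _ _ _)) (Finset.mem_univ u)

theorem pow_add_pos (hM : M ∈ Matrix.rowStochastic ℝ S) {m n : ℕ} {s u w : S}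
    (h₁ : 0 < (M ^ m) s u) (h₂ : 0 < (M ^ n) u w) : 0 < (M ^ (m + n)) s w :=
  (mul_pos h₁ h₂).trans_le (mul_le_pow_add hM m n s u w)

/-- Return times are closed under addition and aperiodicity makes their gcd 1, so they contain all
large integers. -/
theorem eventually_return_pos (hM : M ∈ Matrix.rowStochastic ℝ S) (hap : IsAperiodic M) (s : S) :
    ∃ N : ℕ, ∀ n, N ≤ n → 0 < (M ^ n) s s := by
  let A : Set ℕ := {n | 1 ≤ n ∧ 0 < (M ^ n) s s}
  have hgcd : Nat.setGcd A = 1 :=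
    hap s _ fun n h₁ h₂ => Nat.setGcd_dvd_of_mem (s := A) ⟨h₁, h₂⟩
  obtain ⟨N, hN⟩ := Nat.exists_mem_closure_of_ge A
  refine ⟨N, fun n hn => ?_⟩
  have hmem := hN n hn (by rw [hgcd]; exact one_dvd _)
  refine AddSubmonoid.closure_induction (motive := fun n _ => 0 < (M ^ n) s s)
    (fun n h => h.2) (by simp) (fun a b _ _ ha hb => pow_add_pos hM ha hb) hmem

theorem exists_pow_pos (hM : M ∈ Matrix.rowStochastic ℝ S) (hap : IsAperiodic M) :
    ∃ N : ℕ, ∀ s u : S, (∃ n, 0 < (M ^ n) s u) → 0 < (M ^ N) s u := by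
  choose N₀ hN₀ using eventually_return_pos hM hap
  have hex : ∀ s u : S, ∃ n, (∃ n, 0 < (M ^ n) s u) → 0 < (M ^ n) s u := fun s u => by
    by_cases h : ∃ n, 0 < (M ^ n) s u
    · exact ⟨h.choose, fun _ => h.choose_spec⟩
    · exact ⟨0, fun h' => absurd h' h⟩
  choose n hn using hex
  -- Large enough that subtracting any single `n s u` still leaves at least `N₀ s`: return to `s`
  -- first, then travel to `u`.
  refine ⟨∑ s, N₀ s + ∑ s, ∑ u, n s u, fun s u h => ?_⟩
  have h₁ : n s u ≤ ∑ s, ∑ u, n s u :=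
    (Finset.single_le_sum (f := fun u => n s u) (fun _ _ => Nat.zero_le _)
      (Finset.mem_univ u)).trans
      (Finset.single_le_sum (f := fun s => ∑ u, n s u) (fun _ _ => Nat.zero_le _)
        (Finset.mem_univ s))
  have h₂ : N₀ s ≤ ∑ s, N₀ s :=
    Finset.single_le_sum (f := N₀) (fun _ _ => Nat.zero_le _) (Finset.mem_univ s)
  have h₃ : ∑ s, N₀ s + ∑ s, ∑ u, n s u
      = (∑ s, N₀ s + ∑ s, ∑ u, n s u - n s u) + n s u := by omega
  rw [h₃]
  exact pow_add_pos hM (hN₀ s _ (by omega)) (hn s u h)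

/-- A row of a stochastic matrix whose entry at `v` is at least `δ` averages a function with
values in `[a, b]` to at most `δ f(v) + (1 - δ) b`. -/
theorem row_average_le {P : Matrix S S ℝ} (hP : P ∈ Matrix.rowStochastic ℝ S) {f : S → ℝ}
    {b δ : ℝ} {u v : S} (hf : ∀ w, 0 < P u w → f w ≤ b) (hv : f v ≤ b) (hδ : δ ≤ P u v) :
    ∑ w, P u w * f w ≤ δ * f v + (1 - δ) * b := by
  have h : ∑ w, P u w * (b - f w) ≥ P u v * (b - f v) :=
    Finset.single_le_sum (f := fun w => P u w * (b - f w)) (fun w _ => by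
      rcases (Matrix.nonneg_of_mem_rowStochastic hP (i := u) (j := w)).eq_or_lt with h | h
      · simp [← h]
      · exact mul_nonneg h.le (sub_nonneg.2 (hf w h))) (Finset.mem_univ v)
  have h₂ : ∑ w, P u w * (b - f w) = b - ∑ w, P u w * f w := by
    simp_rw [mul_sub, Finset.sum_sub_distrib, ← Finset.sum_mul,
      Matrix.sum_row_of_mem_rowStochastic hP, one_mul]
  nlinarith [mul_le_mul_of_nonneg_right hδ (sub_nonneg.2 hv)]

theorem le_row_average {P : Matrix S S ℝ} (hP : P ∈ Matrix.rowStochastic ℝ S) {f : S → ℝ}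
    {a δ : ℝ} {u v : S} (hf : ∀ w, 0 < P u w → a ≤ f w) (hv : a ≤ f v) (hδ : δ ≤ P u v) :
    δ * f v + (1 - δ) * a ≤ ∑ w, P u w * f w := by
  have h := row_average_le hP (f := fun w => - f w) (b := -a) (u := u) (v := v) (δ := δ)
    (fun w hw => neg_le_neg (hf w hw)) (neg_le_neg hv) hδ
  simp only [mul_neg, Finset.sum_neg_distrib] at h
  linarith

/-- Doeblin contraction: on the states reachable from `s`, every block of `N` steps shrinks the
range of column `j` by a factor `1 - δ`. -/
theorem exists_tendsto_pow (hM : M ∈ Matrix.rowStochastic ℝ S) (hrec : IsRecurrent M)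
    (hap : IsAperiodic M) : ∃ B, Tendsto (fun t : ℕ => M ^ t) atTop (𝓝 B) := by
  suffices h : ∀ s j, ∃ b, Tendsto (fun t : ℕ => (M ^ t) s j) atTop (𝓝 b) by
    choose B hB using h
    exact ⟨B, tendsto_pi_nhds.2 fun s => tendsto_pi_nhds.2 fun j => hB s j⟩
  intro s j
  obtain ⟨N, hN⟩ := exists_pow_pos hM hap
  let R : S → Prop := fun u => ∃ n, 0 < (M ^ n) s u
  have hRs : R s := ⟨0, by simp⟩
  have hstep : ∀ n u w, R u → 0 < (M ^ n) u w → R w := fun n u w ⟨m, hm⟩ h =>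
    ⟨m + n, pow_add_pos hM hm h⟩
  -- By recurrence every `u` in `R` leads back to `s`, so `δ` can be the least positive entry of
  -- column `s` of `M ^ N`; the default 1 keeps zero entries out of the minimum.
  obtain ⟨δ, hδ0, hδ1, hδ⟩ : ∃ δ : ℝ, 0 < δ ∧ δ ≤ 1 ∧ ∀ u, R u → δ ≤ (M ^ N) u s := by
    have hpos : ∀ u, R u → 0 < (M ^ N) u s := fun u hu => hN u s (hrec s u hu)
    have : Nonempty S := ⟨s⟩
    obtain ⟨u₀, hu₀⟩ :=
      Finite.exists_min fun u => if 0 < (M ^ N) u s then (M ^ N) u s else (1 : ℝ)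
    refine ⟨_, ?_, ?_, fun u hu => (hu₀ u).trans (if_pos (hpos u hu)).le⟩
    · split_ifs with h
      exacts [h, one_pos]
    · split_ifs
      exacts [Matrix.le_one_of_mem_rowStochastic (pow_mem hM N), le_rfl]
  have hcol : ∀ m n u, (M ^ (m + n)) u j = ∑ w, (M ^ m) u w * (M ^ n) w j := fun m n u => by
    rw [pow_add, Matrix.mul_apply]
  have hnest : ∀ m : ℕ, ∃ a b : ℝ, b - a ≤ (1 - δ) ^ m ∧
      ∀ t, N * m ≤ t → ∀ u, R u → a ≤ (M ^ t) u j ∧ (M ^ t) u j ≤ b := by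
    intro m
    induction m with
    | zero =>
      exact ⟨0, 1, by simp, fun t _ u _ => ⟨pow_nonneg_of_rowStochastic hM _ _ _,
        Matrix.le_one_of_mem_rowStochastic (pow_mem hM t)⟩⟩
    | succ m ih =>
      obtain ⟨a, b, hab, h⟩ := ih
      -- The new endpoints reserve weight `δ` for the common value at `s`; only the remaining `1 -
      -- δ` still varies.
      refine ⟨δ * (M ^ (N * m)) s j + (1 - δ) * a, δ * (M ^ (N * m)) s j + (1 - δ) * b, ?_, ?_⟩
      · rw [pow_succ]
        nlinarith [mul_le_mul_of_nonneg_left hab (sub_nonneg.2 hδ1)]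
      · intro t ht
        obtain ⟨n, rfl⟩ := Nat.exists_eq_add_of_le ht
        rw [show N * (m + 1) + n = n + (N + N * m) by ring]
        intro u hu
        have h0 := h (N * m) le_rfl
        have h1 : ∀ u, R u → δ * (M ^ (N * m)) s j + (1 - δ) * a ≤ (M ^ (N + N * m)) u j ∧
            (M ^ (N + N * m)) u j ≤ δ * (M ^ (N * m)) s j + (1 - δ) * b := fun u hu => by
          rw [hcol]
          exact ⟨le_row_average (f := fun w => (M ^ (N * m)) w j) (pow_mem hM N)
              (fun w hw => (h0 w (hstep N u w hu hw)).1) (h0 s hRs).1 (hδ u hu),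
            row_average_le (f := fun w => (M ^ (N * m)) w j) (pow_mem hM N)
              (fun w hw => (h0 w (hstep N u w hu hw)).2) (h0 s hRs).2 (hδ u hu)⟩
        rw [hcol]
        -- Here `δ` is 0: the extra `n` steps only average, so they stay inside the interval.
        have hav := le_row_average (f := fun w => (M ^ (N + N * m)) w j) (pow_mem hM n) (u := u)
          (fun w hw => (h1 w (hstep n u w hu hw)).1) (h1 s hRs).1
          (pow_nonneg_of_rowStochastic hM n u s)
        have hav' := row_average_le (f := fun w => (M ^ (N + N * m)) w j) (pow_mem hM n) (u := u)
          (fun w hw => (h1 w (hstep n u w hu hw)).2) (h1 s hRs).2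
          (pow_nonneg_of_rowStochastic hM n u s)
        constructor <;> linarith
  refine cauchySeq_tendsto_of_complete (Metric.cauchySeq_iff.2 fun ε hε => ?_)
  obtain ⟨m, hm⟩ := exists_pow_lt_of_lt_one hε (show 1 - δ < 1 by linarith)
  obtain ⟨a, b, hab, h⟩ := hnest m
  refine ⟨N * m, fun t ht t' ht' => ?_⟩
  rw [Real.dist_eq, abs_lt]
  have h₁ := h t ht s hRs
  have h₂ := h t' ht' s hRs
  constructor <;> linarith

theorem mul_limitMatrix (hM : M ∈ Matrix.rowStochastic ℝ S) (hrec : IsRecurrent M)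
    (hap : IsAperiodic M) : M * limitMatrix M = limitMatrix M := by
  have hlim : Tendsto (fun t : ℕ => M ^ t) atTop (𝓝 (limitMatrix M)) :=
    tendsto_nhds_limUnder (exists_tendsto_pow hM hrec hap)
  refine tendsto_nhds_unique ((continuous_const.matrix_mul continuous_id).tendsto _ |>.comp hlim)
    (((tendsto_add_atTop_iff_nat 1).2 hlim).congr fun t => ?_)
  simp [pow_succ']

end Markov

/-! ### A minimax theorem -/

/-- By compactness finitely many `y` suffice. The image of `s` in the corresponding coordinates is
then compact, convex and disjoint from the orthant above `c`; a separating functional, normalized,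
gives the weights to mix with. `hX` and `hY` replace convexity because strategies are not mixed
pointwise. -/
theorem exists_lt_of_forall_exists_lt {α β : Type*} [TopologicalSpace α] [TopologicalSpace β]
    {s : Set α} {t : Set β} (hs : IsCompact s) (hs₀ : s.Nonempty) {f : α → β → ℝ}
    (hf : Continuous (Function.uncurry f))
    (hX : ∀ x₁ ∈ s, ∀ x₂ ∈ s, ∀ a b : ℝ, 0 ≤ a → 0 ≤ b → a + b = 1 →
      ∃ x ∈ s, ∀ y ∈ t, f x y = a * f x₁ y + b * f x₂ y)
    (hY : ∀ (u : Finset β), (∀ y ∈ u, y ∈ t) → ∀ w : u → ℝ, (∀ y, 0 ≤ w y) → ∑ y, w y = 1 →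
      ∃ z ∈ t, ∀ x ∈ s, f x z = ∑ y : u, w y * f x y)
    {c : ℝ} (hc : ∀ x ∈ s, ∃ y ∈ t, f x y < c) : ∃ y ∈ t, ∀ x ∈ s, f x y < c := by
  classical
  have hfx : ∀ y, Continuous fun x => f x y := fun y =>
    hf.comp (continuous_id.prodMk continuous_const)
  obtain ⟨u, hut, hu⟩ : ∃ u : Finset β, (∀ y ∈ u, y ∈ t) ∧ ∀ x ∈ s, ∃ y ∈ u, f x y < c := by
    obtain ⟨u, hu⟩ := hs.elim_finite_subcover (fun y : t => {x | f x y < c})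
      (fun y => isOpen_lt (hfx y) continuous_const) fun x hx => by
        obtain ⟨y, hy, h⟩ := hc x hx
        exact Set.mem_iUnion.2 ⟨⟨y, hy⟩, h⟩
    refine ⟨u.image Subtype.val, fun y hy => ?_, fun x hx => ?_⟩
    · obtain ⟨z, -, rfl⟩ := Finset.mem_image.1 hy
      exact z.2
    · obtain ⟨y, hy, h⟩ := Set.mem_iUnion₂.1 (hu hx)
      exact ⟨y, Finset.mem_image_of_mem _ hy, h⟩
  let F : α → u → ℝ := fun x y => f x y
  have hF : Continuous F := continuous_pi fun y => hfx y
  have hconv : Convex ℝ (F '' s) := by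
    rintro _ ⟨x₁, h₁, rfl⟩ _ ⟨x₂, h₂, rfl⟩ a b ha hb hab
    obtain ⟨x, hx, h⟩ := hX x₁ h₁ x₂ h₂ a b ha hb hab
    exact ⟨x, hx, funext fun y => by simp [F, h y (hut y y.2)]⟩
  let E : Set (u → ℝ) := Set.Ici fun _ => c
  have hdisj : Disjoint (F '' s) E := by
    rw [Set.disjoint_left]
    rintro _ ⟨x, hx, rfl⟩ h
    obtain ⟨y, hy, hlt⟩ := hu x hx
    exact absurd (h ⟨y, hy⟩) (not_le.2 hlt)
  obtain ⟨φ, a, b, ha, hab, hb⟩ := geometric_hahn_banach_compact_closed hconv (hs.image hF)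
    (convex_Ici _) isClosed_Ici hdisj
  let w : u → ℝ := fun y => φ (Pi.single y 1)
  have hφ : ∀ z, φ z = ∑ y, w y * z y := fun z => by
    conv_lhs => rw [pi_eq_sum_univ' z]
    simp [w, map_sum, mul_comm]
  have hw : ∀ y, 0 ≤ w y := by
    intro y
    -- A negative weight would let `φ` fall below `b` far out along that coordinate of the orthant.
    by_contra! hneg
    obtain ⟨n, hn⟩ := exists_nat_gt ((b - φ fun _ => c) / w y)
    have hmem : ((fun _ => c) + (n : ℝ) • Pi.single y 1 : u → ℝ) ∈ E := fun y' => by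
      simp only [Pi.add_apply, Pi.smul_apply, smul_eq_mul]
      have : (0 : ℝ) ≤ (Pi.single y 1 : u → ℝ) y' := by
        by_cases h : y' = y
        · subst h; simp
        · simp [h]
      nlinarith [(n.cast_nonneg : (0 : ℝ) ≤ n)]
    have h := hb _ hmem
    rw [map_add, map_smul, smul_eq_mul] at h
    rw [div_lt_iff_of_neg hneg] at hn
    linarith [show φ (Pi.single y 1) = w y from rfl]
  obtain ⟨x₀, hx₀⟩ := hs₀
  have hcE : (fun _ => c : u → ℝ) ∈ E := Set.mem_Ici.2 le_rfl
  have hsum : 0 < ∑ y, w y := by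
    refine (Finset.sum_nonneg fun y _ => hw y).lt_of_ne fun h0 => ?_
    have hz : ∀ z, φ z = 0 := fun z => by
      rw [hφ]
      refine Finset.sum_eq_zero fun y hy => ?_
      rw [(Finset.sum_eq_zero_iff_of_nonneg fun y _ => hw y).1 h0.symm y hy, zero_mul]
    have h₁ := ha _ ⟨x₀, hx₀, rfl⟩
    have h₂ := hb _ hcE
    rw [hz] at h₁ h₂
    linarith
  obtain ⟨z, hz, h⟩ := hY u hut (fun y => w y / ∑ y, w y)
    (fun y => div_nonneg (hw y) hsum.le) (by rw [← Finset.sum_div, div_self hsum.ne'])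
  refine ⟨z, hz, fun x hx => ?_⟩
  rw [h x hx]
  have h₁ := ha _ ⟨x, hx, rfl⟩
  have h₂ := hb _ hcE
  rw [hφ] at h₁ h₂
  rw [← Finset.sum_mul] at h₂
  simp_rw [div_mul_eq_mul_div]
  rw [← Finset.sum_div, div_lt_iff₀ hsum]
  linarith [show ∑ y, w y * F x y = ∑ y : u, w y * f x y from rfl]

/-- Some `y ∈ t` minimizes `sup_{x ∈ s} f x y`. -/
theorem exists_min_upperBound {α β : Type*} [TopologicalSpace α] [TopologicalSpace β]
    {s : Set α} {t : Set β} (hs : IsCompact s) (ht : IsCompact t) (ht₀ : t.Nonempty)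
    {f : α → β → ℝ} (hf : Continuous (Function.uncurry f)) :
    ∃ y ∈ t, ∀ y' ∈ t, ∀ v, (∀ x ∈ s, f x y' ≤ v) → ∀ x ∈ s, f x y ≤ v := by
  have hswap : Continuous (Function.uncurry fun y x => f x y) :=
    hf.comp (continuous_snd.prodMk continuous_fst)
  obtain ⟨y, hy, hmin⟩ := ht.exists_isMinOn ht₀
    (hs.continuous_sSup (f := fun y x => f x y) hswap).continuousOn
  refine ⟨y, hy, fun y' hy' v hv x hx => ?_⟩
  have hfx : Continuous fun x => f x y := hf.comp (continuous_id.prodMk continuous_const)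
  have h₁ : f x y ≤ sSup ((fun x => f x y) '' s) := le_csSup (hs.image hfx).bddAbove ⟨x, hx, rfl⟩
  have h₂ : sSup ((fun x => f x y) '' s) ≤ sSup ((fun x => f x y') '' s) := hmin hy'
  refine h₁.trans (h₂.trans (csSup_le (Set.Nonempty.image _ ⟨x, hx⟩) ?_))
  rintro _ ⟨x', hx', rfl⟩
  exact hv x' hx'

/-- With `v` the max-min, each `c > v` admits some `y` holding the payoff below `c`; the minimizer
`y₀` of the supremum does at least as well for all these `c`, hence holds it to `v`. -/
theorem exists_saddle {α β : Type*} [TopologicalSpace α] [TopologicalSpace β]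
    {s : Set α} {t : Set β} (hs : IsCompact s) (hs₀ : s.Nonempty) (ht : IsCompact t)
    (ht₀ : t.Nonempty) {f : α → β → ℝ} (hf : Continuous (Function.uncurry f))
    (hX : ∀ x₁ ∈ s, ∀ x₂ ∈ s, ∀ a b : ℝ, 0 ≤ a → 0 ≤ b → a + b = 1 →
      ∃ x ∈ s, ∀ y ∈ t, f x y = a * f x₁ y + b * f x₂ y)
    (hY : ∀ (u : Finset β), (∀ y ∈ u, y ∈ t) → ∀ w : u → ℝ, (∀ y, 0 ≤ w y) → ∑ y, w y = 1 →
      ∃ z ∈ t, ∀ x ∈ s, f x z = ∑ y : u, w y * f x y) :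
    ∃ v : ℝ, (∃ x ∈ s, ∀ y ∈ t, v ≤ f x y) ∧ ∃ y ∈ t, ∀ x ∈ s, f x y ≤ v := by
  have hfy : ∀ x, Continuous fun y => f x y := fun x =>
    hf.comp (continuous_const.prodMk continuous_id)
  obtain ⟨x₀, hx₀, hmax⟩ := hs.exists_isMaxOn hs₀ (ht.continuous_sInf hf).continuousOn
  obtain ⟨y₀, hy₀, hmin⟩ := exists_min_upperBound hs ht ht₀ hf
  have hle : ∀ x y, y ∈ t → sInf (f x '' t) ≤ f x y := fun x y hy =>
    csInf_le (ht.image (hfy x)).bddBelow ⟨y, hy, rfl⟩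
  refine ⟨sInf (f x₀ '' t), ⟨x₀, hx₀, hle x₀⟩, y₀, hy₀, fun x hx => ?_⟩
  refine le_of_forall_gt_imp_ge_of_dense fun c hc => ?_
  obtain ⟨y, hy, h⟩ := exists_lt_of_forall_exists_lt hs hs₀ hf hX hY (c := c) fun x hx => by
    obtain ⟨y, hy, h⟩ := (ht.image (hfy x)).sInf_mem (ht₀.image _)
    exact ⟨y, hy, h.trans_lt (lt_of_le_of_lt (hmax hx) hc)⟩
  exact hmin y hy c (fun x hx => (h x hx).le) x hx

/-! ### Strategies of one player -/

section Strategy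

variable {H S A : Type*} [Fintype A]

/-- The mixed actions of the first stage. -/
def Strategy.first (σ : Strategy H S A) (k : S) : stdSimplex ℝ A := σ 0 Fin.elim0 fun _ => k

/-- The strategy used from the second stage on, when `h` and `k` are the actions and the state of
the first stage. -/
def Strategy.shift (σ : Strategy H S A) (h : H) (k : S) : Strategy H S A :=
  fun t h' s => σ (t + 1) (Fin.cons h h') (Fin.cons k s)

/-- Play `x` at the first stage, and then the strategy `c h` if `h` was announced. -/
def Strategy.combine (x : S → stdSimplex ℝ A) (c : H → Strategy H S A) : Strategy H S A
  | 0, _, s => x (s 0)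
  | t + 1, h, s => c (h 0) t (Fin.tail h) (Fin.tail s)

@[simp] theorem Strategy.first_combine (x : S → stdSimplex ℝ A) (c : H → Strategy H S A) (k : S) :
    (Strategy.combine x c).first k = x k := rfl

@[simp] theorem Strategy.shift_combine (x : S → stdSimplex ℝ A) (c : H → Strategy H S A) (h : H)
    (k : S) : (Strategy.combine x c).shift h k = c h := rfl

theorem Strategy.continuous_first (k : S) (a : A) :
    Continuous fun σ : Strategy H S A => (σ.first k).1 a := by
  exact (continuous_apply a).comp (continuous_subtype_val.comp ((continuous_apply (fun _ => k)).comp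
    ((continuous_apply Fin.elim0).comp (continuous_apply 0))))

theorem Strategy.continuous_shift (h : H) (k : S) :
    Continuous fun σ : Strategy H S A => σ.shift h k := by
  unfold Strategy.shift
  fun_prop

/-- The strategy that always plays the uniform mixed action. -/
noncomputable def uniformStrategy (H S A : Type*) [Fintype A] [Nonempty A] : Strategy H S A :=
  fun _ _ _ => ⟨fun _ => (Fintype.card A : ℝ)⁻¹, fun _ => by positivity, by simp⟩

/-- The identity is multiplied by the total weight, so it remains true, for any choice of `z`, when
all weights vanish. -/
theorem exists_mixture {E : Type*} [Fintype E] [Nonempty E] {w : E → ℝ} (hw : ∀ e, 0 ≤ w e)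
    (x : E → stdSimplex ℝ A) :
    ∃ z : stdSimplex ℝ A, ∀ a, (∑ e, w e) * z.1 a = ∑ e, w e * (x e).1 a := by
  by_cases h : ∑ e, w e = 0
  · refine ⟨x (Classical.arbitrary E), fun a => ?_⟩
    rw [h, zero_mul, Finset.sum_eq_zero]
    intro e he
    rw [(Finset.sum_eq_zero_iff_of_nonneg fun e _ => hw e).1 h e he, zero_mul]
  · refine ⟨⟨fun a => (∑ e, w e * (x e).1 a) / ∑ e, w e, fun a => ?_, ?_⟩, fun a => ?_⟩
    · exact div_nonneg (Finset.sum_nonneg fun e _ => mul_nonneg (hw e) ((x e).2.1 a))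
        (Finset.sum_nonneg fun e _ => hw e)
    · rw [← Finset.sum_div, Finset.sum_comm]
      simp_rw [← Finset.mul_sum, (x _).2.2, mul_one]
      exact div_self h
    · exact mul_div_cancel₀ _ h

open Classical in
/-- The mixture of the mixed actions `x e` with weights proportional to `w e`. -/
noncomputable def mixture {E : Type*} [Fintype E] [Nonempty E] (w : E → ℝ)
    (x : E → stdSimplex ℝ A) : stdSimplex ℝ A :=
  if h : ∃ z : stdSimplex ℝ A, ∀ a, (∑ e, w e) * z.1 a = ∑ e, w e * (x e).1 a then h.choose
  else x (Classical.arbitrary E)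

theorem sum_mul_mixture {E : Type*} [Fintype E] [Nonempty E] {w : E → ℝ} (hw : ∀ e, 0 ≤ w e)
    (x : E → stdSimplex ℝ A) (a : A) :
    (∑ e, w e) * (mixture w x).1 a = ∑ e, w e * (x e).1 a := by
  rw [mixture, dif_pos (exists_mixture hw x)]
  exact (exists_mixture hw x).choose_spec a

end Strategy

/-! ### One player's beliefs and strategies -/

/-- The data of one player: the action read off the announced one, the transition matrix of the
state, and a matrix `lim` that absorbs it on the left. -/
structure Side (H S A : Type*) [Fintype S] [DecidableEq S] where
  /-- the action of the player in an announced pair of actions -/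
  act : H → A
  /-- the transition matrix -/
  trans : Matrix S S ℝ
  /-- the limit of the powers of the transition matrix -/
  lim : Matrix S S ℝ
  act_surjective : Function.Surjective act
  trans_mem : trans ∈ Matrix.rowStochastic ℝ S
  trans_mul_lim : trans * lim = lim

namespace Side

variable {H S A : Type*} [Fintype S] [DecidableEq S] (P : Side H S A)

/-- The law of the next state. -/
def row (k : S) : S → ℝ := fun k' => P.trans k k'

theorem trans_nonneg (k k' : S) : 0 ≤ P.trans k k' :=
  Matrix.nonneg_of_mem_rowStochastic P.trans_mem

theorem sum_trans (k : S) : ∑ k', P.trans k k' = 1 :=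
  Matrix.sum_row_of_mem_rowStochastic P.trans_mem k

theorem row_nonneg (k k' : S) : 0 ≤ P.row k k' := P.trans_nonneg k k'

theorem row_mem (k : S) : P.row k ∈ stdSimplex ℝ S :=
  ⟨P.trans_nonneg k, P.sum_trans k⟩

theorem vecMul_trans_lim (p : S → ℝ) : p ᵥ* P.trans ᵥ* P.lim = p ᵥ* P.lim := by
  rw [Matrix.vecMul_vecMul, P.trans_mul_lim]

theorem sum_vecMul_trans (p : S → ℝ) : ∑ k, (p ᵥ* P.trans) k = ∑ k, p k := by
  simp_rw [Matrix.vecMul, dotProduct]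
  rw [Finset.sum_comm]
  simp_rw [← Finset.mul_sum, P.sum_trans, mul_one]

theorem vecMul_trans_pow_lim (p : S → ℝ) (t : ℕ) : p ᵥ* P.trans ^ t ᵥ* P.lim = p ᵥ* P.lim := by
  induction t with
  | zero => simp
  | succ t ih => rw [pow_succ, ← Matrix.vecMul_vecMul, vecMul_trans_lim, ih]

theorem sum_vecMul_trans_pow (p : S → ℝ) (t : ℕ) : ∑ k, (p ᵥ* P.trans ^ t) k = ∑ k, p k := by
  induction t with
  | zero => simp
  | succ t ih => rw [pow_succ, ← Matrix.vecMul_vecMul, sum_vecMul_trans, ih]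

theorem vecMul_trans_mem {p : S → ℝ} (hp : p ∈ stdSimplex ℝ S) :
    p ᵥ* P.trans ∈ stdSimplex ℝ S :=
  ⟨fun _ => Finset.sum_nonneg fun k _ => mul_nonneg (hp.1 k) (P.trans_nonneg _ _),
    (P.sum_vecMul_trans p).trans hp.2⟩

theorem sum_smul_row (p : S → ℝ) : ∑ k, p k • P.row k = p ᵥ* P.trans := by
  funext k'
  simp [row, Matrix.vecMul, dotProduct]

variable [Fintype A]

/-- The joint law of the actions of the player and the next state: `bel t p σ h k` is the factor of
the probability that `h` is announced in the first `t` stages, and that the state of stage `t + 1`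
is `k`, which is due to the player. -/
noncomputable def bel : (t : ℕ) → (S → ℝ) → Strategy H S A → (Fin t → H) → S → ℝ
  | 0, p, _, _ => p
  | t + 1, p, σ, h => ∑ k, (p k * (σ.first k).1 (P.act (h 0))) •
      bel t (P.row k) (σ.shift (h 0) k) (Fin.tail h)

/-- Linearity in the initial law lets all conditioning be done with unnormalized laws, without
division. -/
theorem bel_sum_smul {E : Type*} (s : Finset E) (c : E → ℝ) (μ : E → S → ℝ) (t : ℕ)
    (σ : Strategy H S A) (h : Fin t → H) :
    P.bel t (∑ e ∈ s, c e • μ e) σ h = ∑ e ∈ s, c e • P.bel t (μ e) σ h := by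
  cases t with
  | zero => rfl
  | succ t =>
    simp only [bel, Finset.smul_sum, smul_smul, Finset.sum_apply, Pi.smul_apply, smul_eq_mul]
    rw [Finset.sum_comm]
    refine Finset.sum_congr rfl fun k _ => ?_
    rw [Finset.sum_mul, Finset.sum_smul]
    exact Finset.sum_congr rfl fun e _ => by rw [mul_assoc]

theorem bel_smul (c : ℝ) (p : S → ℝ) (t : ℕ) (σ : Strategy H S A) (h : Fin t → H) :
    P.bel t (c • p) σ h = c • P.bel t p σ h := by
  simpa using P.bel_sum_smul {()} (fun _ => c) (fun _ => p) t σ h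

theorem bel_nonneg {p : S → ℝ} (hp : ∀ k, 0 ≤ p k) (t : ℕ) (σ : Strategy H S A)
    (h : Fin t → H) (k : S) : 0 ≤ P.bel t p σ h k := by
  induction t generalizing p σ k with
  | zero => exact hp k
  | succ t ih =>
    simp only [bel, Finset.sum_apply, Pi.smul_apply, smul_eq_mul]
    exact Finset.sum_nonneg fun k' _ => mul_nonneg (mul_nonneg (hp k') ((σ.first k').2.1 _))
      (ih (P.row_nonneg k') _ _ _)

theorem continuous_bel (t : ℕ) (p : S → ℝ) (h : Fin t → H) :
    Continuous fun σ : Strategy H S A => P.bel t p σ h := by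
  induction t generalizing p with
  | zero => exact continuous_const
  | succ t ih =>
    simp only [bel]
    exact continuous_finsetSum _ fun k _ => (continuous_const.mul
      (Strategy.continuous_first k _)).smul ((ih _ _).comp (Strategy.continuous_shift _ k))

/-- Uniform play reveals nothing, so only the chain moves the belief. This strategy shows that
non-revealing strategies exist, and as a fully mixed opponent it gives positive weight to every
history. -/
theorem bel_uniformStrategy [Nonempty A] (t : ℕ) (p : S → ℝ) (h : Fin t → H) :
    P.bel t p (uniformStrategy H S A) h
      = (Fintype.card A : ℝ)⁻¹ ^ t • (p ᵥ* P.trans ^ t) := by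
  induction t generalizing p with
  | zero => simp [bel]
  | succ t ih =>
    have h₁ : P.bel (t + 1) p (uniformStrategy H S A) h
        = ∑ k, (p k * (Fintype.card A : ℝ)⁻¹) • P.bel t (P.row k) (uniformStrategy H S A)
            (Fin.tail h) := rfl
    rw [h₁, ← bel_sum_smul]
    simp_rw [mul_comm (p _), mul_smul]
    rw [← Finset.smul_sum]
    rw [sum_smul_row, bel_smul, ih, smul_smul, Matrix.vecMul_vecMul, ← pow_succ', ← pow_succ']

theorem sum_bel_uniformStrategy_pos [Nonempty A] {p : S → ℝ} (hp : p ∈ stdSimplex ℝ S) (t : ℕ)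
    (h : Fin t → H) : 0 < ∑ k, P.bel t p (uniformStrategy H S A) h k := by
  rw [bel_uniformStrategy]
  simp_rw [Pi.smul_apply, ← Finset.smul_sum]
  rw [sum_vecMul_trans_pow, hp.2, smul_eq_mul, mul_one]
  positivity

/-! ### Mixtures of strategies -/

/-- The mixture, stage by stage, of the strategies `σ e` with initial weights `μ e`. -/
noncomputable def mixAux {E : Type*} [Fintype E] [Nonempty E] :
    (t : ℕ) → (E → S → ℝ) → (E → Strategy H S A) → (Fin t → H) → (Fin (t + 1) → S) →
      stdSimplex ℝ A
  | 0, μ, σ, _, s => mixture (fun e => μ e (s 0)) fun e => (σ e).first (s 0)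
  | t + 1, μ, σ, h, s =>
      mixAux t (fun e => (μ e (s 0) * ((σ e).first (s 0)).1 (P.act (h 0))) • P.row (s 0))
        (fun e => (σ e).shift (h 0) (s 0)) (Fin.tail h) (Fin.tail s)

/-- The strategy that realizes the mixture of the strategies `σ e` with initial (unnormalized) laws
of the state `μ e`. -/
noncomputable def mix {E : Type*} [Fintype E] [Nonempty E] (μ : E → S → ℝ)
    (σ : E → Strategy H S A) : Strategy H S A :=
  fun t h s => P.mixAux t μ σ h s

variable {E : Type*} [Fintype E] [Nonempty E]

theorem sum_mul_first_mix {μ : E → S → ℝ} (hμ : ∀ e k, 0 ≤ μ e k) (σ : E → Strategy H S A)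
    (k : S) (a : A) : (∑ e, μ e k) * ((P.mix μ σ).first k).1 a
      = ∑ e, μ e k * ((σ e).first k).1 a :=
  sum_mul_mixture (fun e => hμ e k) _ a

theorem shift_mix (μ : E → S → ℝ) (σ : E → Strategy H S A) (h : H) (k : S) :
    (P.mix μ σ).shift h k = P.mix (fun e => (μ e k * ((σ e).first k).1 (P.act h)) • P.row k)
      fun e => (σ e).shift h k := rfl

/-- Kuhn's argument: after a state and an announced pair, the weight of `e` is multiplied by the
probability with which `σ e` chose the observed action. The first-stage mixture has exactly the
total of these weights, and linearity carries the induction. -/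
theorem bel_mix {μ : E → S → ℝ} (hμ : ∀ e k, 0 ≤ μ e k) (σ : E → Strategy H S A) (t : ℕ)
    (h : Fin t → H) : P.bel t (∑ e, μ e) (P.mix μ σ) h = ∑ e, P.bel t (μ e) (σ e) h := by
  induction t generalizing μ σ with
  | zero => rfl
  | succ t ih =>
    simp only [bel]
    rw [Finset.sum_comm]
    refine Finset.sum_congr rfl fun k _ => ?_
    rw [Finset.sum_apply, P.sum_mul_first_mix hμ, ← bel_smul, Finset.sum_smul, shift_mix, ih]
    · simp_rw [bel_smul]
    · exact fun e k' => mul_nonneg (mul_nonneg (hμ e k) (((σ e).first k).2.1 _))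
        (P.row_nonneg k k')

/-! ### Non-revealing strategies -/

/-- Whatever is announced, the (unnormalized) belief is mapped to a multiple of `r` by `P.lim`. -/
def KeepsAt (r p : S → ℝ) (σ : Strategy H S A) : Prop :=
  ∀ (t : ℕ) (h : Fin t → H), P.bel t p σ h ᵥ* P.lim = (∑ k, P.bel t p σ h k) • r

/-- The non-revealing strategies at `p`. -/
def nonRevealing (p : S → ℝ) : Set (Strategy H S A) := {σ | P.KeepsAt (p ᵥ* P.lim) p σ}

variable {P}

/-- The condition is linear in the belief once `r` is common to all components. -/
theorem KeepsAt.mix {r : S → ℝ} {μ : E → S → ℝ} (hμ : ∀ e k, 0 ≤ μ e k)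
    {σ : E → Strategy H S A} (h : ∀ e, P.KeepsAt r (μ e) (σ e)) :
    P.KeepsAt r (∑ e, μ e) (P.mix μ σ) := by
  intro t h'
  rw [P.bel_mix hμ, Matrix.sum_vecMul]
  simp_rw [Finset.sum_apply]
  rw [Finset.sum_comm, Finset.sum_smul]
  exact Finset.sum_congr rfl fun e _ => h e t h'

theorem keepsAt_smul_iff {r p : S → ℝ} {σ : Strategy H S A} {c : ℝ} (hc : c ≠ 0) :
    P.KeepsAt r (c • p) σ ↔ P.KeepsAt r p σ := by
  refine forall₂_congr fun t h => ?_
  rw [bel_smul, Matrix.smul_vecMul]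
  simp_rw [Pi.smul_apply, ← Finset.smul_sum]
  rw [smul_assoc]
  exact (smul_right_injective _ hc).eq_iff

theorem KeepsAt.smul {r p : S → ℝ} {σ : Strategy H S A} (h : P.KeepsAt r p σ) (c : ℝ) :
    P.KeepsAt r (c • p) σ := by
  intro t h'
  rw [bel_smul, Matrix.smul_vecMul, h]
  simp_rw [Pi.smul_apply, ← Finset.smul_sum]
  rw [smul_assoc]

variable (P)

/-- Strategies form a product of simplices, compact by Tychonoff, and each constraint is a closed
condition since `bel` is continuous. -/
theorem isCompact_nonRevealing (p : S → ℝ) : IsCompact (P.nonRevealing p) := by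
  refine IsClosed.isCompact ?_
  simp only [nonRevealing, KeepsAt, Set.ofPred_forall]
  refine isClosed_iInter fun t => isClosed_iInter fun h => ?_
  have hb := P.continuous_bel t p h
  exact isClosed_eq (hb.matrix_vecMul continuous_const) ((continuous_finsetSum _ fun k _ =>
    (continuous_apply k).comp hb).smul continuous_const)

theorem uniformStrategy_mem [Nonempty A] {p : S → ℝ} (hp : p ∈ stdSimplex ℝ S) :
    uniformStrategy H S A ∈ P.nonRevealing p := by
  intro t h
  rw [bel_uniformStrategy, Matrix.smul_vecMul]
  simp_rw [Pi.smul_apply, ← Finset.smul_sum]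
  rw [vecMul_trans_pow_lim, sum_vecMul_trans_pow, hp.2, smul_eq_mul, mul_one]

end Side

/-! ### One-stage actions -/

section OneStage

variable {S A : Type*} [Fintype S]

theorem actionProb_nonneg {p : S → ℝ} (hp : ∀ k, 0 ≤ p k) {x : S → A → ℝ}
    (hx : ∀ k a, 0 ≤ x k a) (a : A) : 0 ≤ actionProb p x a :=
  Finset.sum_nonneg fun k _ => mul_nonneg (hp k) (hx k a)

/-- When the action has probability 0, every term on the right vanishes too, so no positivity of
that probability is needed. -/
theorem actionProb_smul_bayes {p : S → ℝ} (hp : ∀ k, 0 ≤ p k) {x : S → A → ℝ}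
    (hx : ∀ k a, 0 ≤ x k a) (a : A) :
    actionProb p x a • bayes p x a = fun k => p k * x k a := by
  funext k
  rw [Pi.smul_apply, smul_eq_mul, bayes]
  by_cases h : actionProb p x a = 0
  · rw [h, zero_mul]
    exact ((Finset.sum_eq_zero_iff_of_nonneg fun k _ => mul_nonneg (hp k) (hx k a)).1 h k
      (Finset.mem_univ k)).symm
  · exact mul_div_cancel₀ _ h

theorem bayes_mem {p : S → ℝ} (hp : ∀ k, 0 ≤ p k) {x : S → A → ℝ}
    (hx : ∀ k a, 0 ≤ x k a) {a : A} (ha : 0 < actionProb p x a) :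
    bayes p x a ∈ stdSimplex ℝ S := by
  refine ⟨fun k => div_nonneg (mul_nonneg (hp k) (hx k a)) ha.le, ?_⟩
  simp_rw [bayes]
  rw [← Finset.sum_div]
  exact div_self ha.ne'

theorem Side.sum_smul_row_actionProb {H : Type*} [DecidableEq S] [Fintype A] (P : Side H S A) {p : S → ℝ}
    (hp : ∀ k, 0 ≤ p k) {x : S → A → ℝ} (hx : ∀ k a, 0 ≤ x k a) (a : A) :
    ∑ k, (p k * x k a) • P.row k = actionProb p x a • (bayes p x a ᵥ* P.trans) := by
  rw [← Matrix.smul_vecMul, actionProb_smul_bayes hp hx]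
  exact P.sum_smul_row _

variable {H : Type*} [DecidableEq S] [Fintype A] (P : Side H S A)

/-- This is the non-revealing condition for one-stage histories, with the transition removed by
`vecMul_trans_lim`. -/
theorem Side.first_mem_NR {p : S → ℝ} (hp : ∀ k, 0 ≤ p k) {σ : Strategy H S A}
    (hσ : σ ∈ P.nonRevealing p) : (fun k => (σ.first k).1) ∈ NR P.lim p := by
  refine ⟨fun k => (σ.first k).2, fun a ha => ?_⟩
  obtain ⟨h, rfl⟩ := P.act_surjective a
  have h₁ := hσ 1 fun _ => h
  have h₂ : P.bel 1 p σ (fun _ => h) = ∑ k, (p k * (σ.first k).1 (P.act h)) • P.row k := rfl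
  have hmem := P.vecMul_trans_mem (bayes_mem hp (fun k => (σ.first k).2.1) ha)
  rw [h₂, P.sum_smul_row_actionProb hp fun k => (σ.first k).2.1] at h₁
  simp_rw [Pi.smul_apply, ← Finset.smul_sum] at h₁
  rw [hmem.2, Matrix.smul_vecMul, P.vecMul_trans_lim, smul_eq_mul, mul_one] at h₁
  exact smul_right_injective _ ha.ne' h₁

theorem Side.combine_mem {p : S → ℝ} (hp : p ∈ stdSimplex ℝ S) {x : S → stdSimplex ℝ A}
    (hx : (fun k => (x k).1) ∈ NR P.lim p) {c : H → Strategy H S A}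
    (hc : ∀ h, 0 < actionProb p (fun k => (x k).1) (P.act h) →
      c h ∈ P.nonRevealing (bayes p (fun k => (x k).1) (P.act h) ᵥ* P.trans)) :
    Strategy.combine x c ∈ P.nonRevealing p := by
  intro t h
  cases t with
  | zero =>
    change p ᵥ* P.lim = (∑ k, p k) • p ᵥ* P.lim
    rw [hp.2, one_smul]
  | succ t =>
    have h₁ : P.bel (t + 1) p (Strategy.combine x c) h
        = ∑ k, (p k * (x k).1 (P.act (h 0))) • P.bel t (P.row k) (c (h 0)) (Fin.tail h) := rfl
    rw [h₁, ← P.bel_sum_smul, P.sum_smul_row_actionProb (x := fun k => (x k).1) hp.1 fun k => (x k).2.1]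
    -- An action of probability 0 produces the zero belief, so the continuation after it is
    -- unconstrained.
    rcases (actionProb_nonneg hp.1 (fun k => (x k).2.1) (P.act (h 0))).eq_or_lt with h0 | h0
    · rw [← h0, zero_smul, ← zero_smul ℝ (0 : S → ℝ), P.bel_smul]
      simp
    · have h₂ := hc (h 0) h0
      rw [Side.nonRevealing, P.vecMul_trans_lim, hx.2 _ h0] at h₂
      exact KeepsAt.smul h₂ _ t _

/-- The continuation of `σ` depends on the private first state; mixing over it with posterior
weights gives one strategy started at the next belief. Its belief after `h'` is, up to a scalar,
that of `σ` after `h` followed by `h'`. -/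
theorem Side.mix_shift_mem {p : S → ℝ} [Nonempty S] (hp : ∀ k, 0 ≤ p k) {σ : Strategy H S A}
    (hσ : σ ∈ P.nonRevealing p) (h : H)
    (h0 : 0 < actionProb p (fun k => (σ.first k).1) (P.act h)) :
    P.mix (fun k => (p k * (σ.first k).1 (P.act h)) • P.row k) (fun k => σ.shift h k) ∈
      P.nonRevealing (bayes p (fun k => (σ.first k).1) (P.act h) ᵥ* P.trans) := by
  have hx : ∀ k a, 0 ≤ (σ.first k).1 a := fun k => (σ.first k).2.1
  rw [Side.nonRevealing, Set.mem_ofPred_eq, P.vecMul_trans_lim,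
    (P.first_mem_NR hp hσ).2 _ h0, ← Side.keepsAt_smul_iff h0.ne', ← P.sum_smul_row_actionProb hp hx]
  intro t h'
  rw [P.bel_mix (μ := fun k => (p k * (σ.first k).1 (P.act h)) • P.row k) fun k k' => mul_nonneg (mul_nonneg (hp k) (hx k _)) (P.row_nonneg k k')]
  simp_rw [P.bel_smul]
  exact hσ (t + 1) (Fin.cons h h')

end OneStage

/-! ### The non-revealing game -/

section Game

variable {H K L A A' : Type*} [Fintype H] [Fintype K] [DecidableEq K] [Fintype L] [DecidableEq L]
  [Fintype A] [Fintype A'] (P : Side H K A) (Q : Side H L A') (g : K → L → H → ℝ)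

/-- The expected total payoff of the first `T` stages, bilinear in the initial laws. -/
noncomputable def total : (T : ℕ) → (K → ℝ) → (L → ℝ) → Strategy H K A → Strategy H L A' → ℝ
  | 0, _, _, _, _ => 0
  | T + 1, p, q, σ, τ => ∑ k, ∑ l, ∑ h,
      p k * q l * ((σ.first k).1 (P.act h) * (τ.first l).1 (Q.act h)) *
        (g k l h + total T (P.row k) (Q.row l) (σ.shift h k) (τ.shift h l))

/-- Exchanging the players and negating the payoff transfers each result about the first player to
the second. -/
theorem total_swap (T : ℕ) (p : K → ℝ) (q : L → ℝ) (σ : Strategy H K A)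
    (τ : Strategy H L A') :
    total Q P (fun l k h => -g k l h) T q p τ σ = -total P Q g T p q σ τ := by
  induction T generalizing p q σ τ with
  | zero => simp [total]
  | succ T ih =>
    simp only [total, ← Finset.sum_neg_distrib]
    rw [Finset.sum_comm]
    refine Finset.sum_congr rfl fun k _ => Finset.sum_congr rfl fun l _ =>
      Finset.sum_congr rfl fun h _ => ?_
    rw [ih]
    ring

theorem total_sum_smul {E : Type*} (s : Finset E) (c : E → ℝ) (μ : E → K → ℝ) (T : ℕ)
    (q : L → ℝ) (σ : Strategy H K A) (τ : Strategy H L A') :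
    total P Q g T (∑ e ∈ s, c e • μ e) q σ τ = ∑ e ∈ s, c e * total P Q g T (μ e) q σ τ := by
  cases T with
  | zero => simp [total]
  | succ T =>
    simp only [total, Finset.mul_sum, Finset.sum_apply, Pi.smul_apply, smul_eq_mul, Finset.sum_mul]
    rw [Finset.sum_comm' (t' := Finset.univ) (s' := fun _ => s) (by simp)]
    refine Finset.sum_congr rfl fun k _ => ?_
    rw [Finset.sum_comm' (t' := Finset.univ) (s' := fun _ => s) (by simp)]
    refine Finset.sum_congr rfl fun l _ => ?_
    rw [Finset.sum_comm' (t' := Finset.univ) (s' := fun _ => s) (by simp)]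
    refine Finset.sum_congr rfl fun h _ => Finset.sum_congr rfl fun e _ => ?_
    ring

theorem total_smul (c : ℝ) (T : ℕ) (p : K → ℝ) (q : L → ℝ) (σ : Strategy H K A)
    (τ : Strategy H L A') : total P Q g T (c • p) q σ τ = c * total P Q g T p q σ τ := by
  simpa using total_sum_smul P Q g {()} (fun _ => c) (fun _ => p) T q σ τ

theorem total_sum_smul_right {E : Type*} (s : Finset E) (c : E → ℝ) (μ : E → L → ℝ) (T : ℕ)
    (p : K → ℝ) (σ : Strategy H K A) (τ : Strategy H L A') :
    total P Q g T p (∑ e ∈ s, c e • μ e) σ τ = ∑ e ∈ s, c e * total P Q g T p (μ e) σ τ := by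
  have h := total_sum_smul Q P (fun l k h => -g k l h) s c μ T p τ σ
  simp_rw [total_swap, mul_neg, Finset.sum_neg_distrib] at h
  exact neg_injective h

theorem total_smul_right (c : ℝ) (T : ℕ) (p : K → ℝ) (q : L → ℝ) (σ : Strategy H K A)
    (τ : Strategy H L A') : total P Q g T p (c • q) σ τ = c * total P Q g T p q σ τ := by
  simpa using total_sum_smul_right P Q g {()} (fun _ => c) (fun _ => q) T p σ τ

theorem total_succ (T : ℕ) (p : K → ℝ) (q : L → ℝ) (σ : Strategy H K A)
    (τ : Strategy H L A') :
    total P Q g (T + 1) p q σ τ =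
      ∑ k, ∑ l, ∑ h, p k * q l * ((σ.first k).1 (P.act h) * (τ.first l).1 (Q.act h)) * g k l h +
      ∑ h, ∑ l, (q l * (τ.first l).1 (Q.act h)) * ∑ k, (p k * (σ.first k).1 (P.act h)) *
        total P Q g T (P.row k) (Q.row l) (σ.shift h k) (τ.shift h l) := by
  simp only [total, mul_add, Finset.sum_add_distrib, Finset.mul_sum]
  refine congrArg _ ?_
  rw [Finset.sum_comm]
  conv_rhs => rw [Finset.sum_comm]
  refine Finset.sum_congr rfl fun l _ => ?_
  rw [Finset.sum_comm]
  refine Finset.sum_congr rfl fun h _ => Finset.sum_congr rfl fun k _ => ?_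
  ring

/-- The counterpart of `bel_mix` for payoffs: the mixture yields the sum of the payoffs against
every opponent. -/
theorem total_mix {E : Type*} [Fintype E] [Nonempty E] {μ : E → K → ℝ} (hμ : ∀ e k, 0 ≤ μ e k)
    (σ : E → Strategy H K A) (T : ℕ) (q : L → ℝ) (τ : Strategy H L A') :
    total P Q g T (∑ e, μ e) q (P.mix μ σ) τ = ∑ e, total P Q g T (μ e) q (σ e) τ := by
  induction T generalizing μ σ q τ with
  | zero => simp [total]
  | succ T ih =>
    simp only [total]
    conv_rhs => rw [Finset.sum_comm]
    refine Finset.sum_congr rfl fun k _ => ?_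
    conv_rhs => rw [Finset.sum_comm]
    refine Finset.sum_congr rfl fun l _ => ?_
    conv_rhs => rw [Finset.sum_comm]
    refine Finset.sum_congr rfl fun h _ => ?_
    have h₁ := P.sum_mul_first_mix hμ σ k (P.act h)
    have h₂ : (∑ e, μ e k) * ((P.mix μ σ).first k).1 (P.act h) *
        total P Q g T (P.row k) (Q.row l) ((P.mix μ σ).shift h k) (τ.shift h l) =
        ∑ e, μ e k * ((σ e).first k).1 (P.act h) *
          total P Q g T (P.row k) (Q.row l) ((σ e).shift h k) (τ.shift h l) := by
      rw [h₁, ← total_smul, Finset.sum_smul, P.shift_mix, ih]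
      · simp_rw [total_smul]
      · exact fun e k' => mul_nonneg (mul_nonneg (hμ e k) (((σ e).first k).2.1 _))
          (P.row_nonneg k k')
    calc _ = (q l * (τ.first l).1 (Q.act h)) * ((∑ e, μ e k) *
          ((P.mix μ σ).first k).1 (P.act h) * g k l h + (∑ e, μ e k) *
          ((P.mix μ σ).first k).1 (P.act h) *
          total P Q g T (P.row k) (Q.row l) ((P.mix μ σ).shift h k) (τ.shift h l)) := by
            rw [Finset.sum_apply]; ring
      _ = _ := by
        rw [h₂, h₁, Finset.sum_mul, ← Finset.sum_add_distrib, Finset.mul_sum]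
        exact Finset.sum_congr rfl fun e _ => by ring

theorem total_mix_right {E : Type*} [Fintype E] [Nonempty E] {μ : E → L → ℝ}
    (hμ : ∀ e k, 0 ≤ μ e k) (τ : E → Strategy H L A') (T : ℕ) (p : K → ℝ)
    (σ : Strategy H K A) :
    total P Q g T p (∑ e, μ e) σ (Q.mix μ τ) = ∑ e, total P Q g T p (μ e) σ (τ e) := by
  have h := total_mix Q P (fun l k h => -g k l h) hμ τ T p σ
  simp_rw [total_swap, Finset.sum_neg_distrib] at h
  exact neg_injective h

theorem continuous_total (T : ℕ) (p : K → ℝ) (q : L → ℝ) :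
    Continuous (Function.uncurry fun (σ : Strategy H K A) (τ : Strategy H L A') =>
      total P Q g T p q σ τ) := by
  induction T generalizing p q with
  | zero => exact continuous_const
  | succ T ih =>
    simp only [total]
    refine continuous_finsetSum _ fun k _ => continuous_finsetSum _ fun l _ =>
      continuous_finsetSum _ fun h _ => ?_
    exact (continuous_const.mul (((Strategy.continuous_first k _).comp continuous_fst).mul
      ((Strategy.continuous_first l _).comp continuous_snd))).mul (continuous_const.add
      ((ih (P.row k) (Q.row l)).comp (((Strategy.continuous_shift h k).comp continuous_fst).prodMk
        ((Strategy.continuous_shift h l).comp continuous_snd))))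

/-- The first player has a non-revealing strategy that guarantees a total payoff of at least `v`
against all the non-revealing strategies of the second player. -/
def Guarantees (T : ℕ) (p : K → ℝ) (q : L → ℝ) (v : ℝ) : Prop :=
  ∃ σ ∈ P.nonRevealing p, ∀ τ ∈ Q.nonRevealing q, v ≤ total P Q g T p q σ τ

/-- The second player has a non-revealing strategy that guarantees a total payoff of at most `v`
against all the non-revealing strategies of the first player. -/
def Defends (T : ℕ) (p : K → ℝ) (q : L → ℝ) (v : ℝ) : Prop :=
  ∃ τ ∈ Q.nonRevealing q, ∀ σ ∈ P.nonRevealing p, total P Q g T p q σ τ ≤ v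

variable {P Q g}

theorem guarantees_swap {T : ℕ} {p : K → ℝ} {q : L → ℝ} {v : ℝ} :
    Guarantees Q P (fun l k h => -g k l h) T q p (-v) ↔ Defends P Q g T p q v := by
  simp only [Guarantees, Defends, total_swap, neg_le_neg_iff]

theorem defends_swap {T : ℕ} {p : K → ℝ} {q : L → ℝ} {v : ℝ} :
    Defends Q P (fun l k h => -g k l h) T q p (-v) ↔ Guarantees P Q g T p q v := by
  simp only [Guarantees, Defends, total_swap, neg_le_neg_iff]

theorem Guarantees.le {T : ℕ} {p : K → ℝ} {q : L → ℝ} {v w : ℝ}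
    (h₁ : Guarantees P Q g T p q v) (h₂ : Defends P Q g T p q w) : v ≤ w := by
  obtain ⟨σ, hσ, h₁⟩ := h₁
  obtain ⟨τ, hτ, h₂⟩ := h₂
  exact (h₁ τ hτ).trans (h₂ σ hσ)

/-- Splitting `p` into the proportional pieces `w e • p` supplies the convexity required by the
minimax theorem. -/
theorem exists_mix_mem {E : Type*} [Fintype E] {p : K → ℝ} (hp : ∀ k, 0 ≤ p k) {w : E → ℝ}
    (hw : ∀ e, 0 ≤ w e) (hw₁ : ∑ e, w e = 1) {σ : E → Strategy H K A}
    (hσ : ∀ e, σ e ∈ P.nonRevealing p) (T : ℕ) (q : L → ℝ) :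
    ∃ σ' ∈ P.nonRevealing p, ∀ τ, total P Q g T p q σ' τ = ∑ e, w e * total P Q g T p q (σ e) τ := by
  have : Nonempty E := by
    by_contra h
    rw [not_nonempty_iff] at h
    simp at hw₁
  have hsum : ∑ e, w e • p = p := by rw [← Finset.sum_smul, hw₁, one_smul]
  have hμ : ∀ e k, 0 ≤ (w e • p) k := fun e k => mul_nonneg (hw e) (hp k)
  refine ⟨P.mix (fun e => w e • p) σ, ?_, fun τ => ?_⟩
  · have h := Side.KeepsAt.mix hμ fun e => (hσ e).smul (w e)
    rwa [hsum] at h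
  · have h := total_mix P Q g hμ σ T q τ
    simp_rw [total_smul] at h
    rwa [hsum] at h

theorem exists_value [Nonempty A] [Nonempty A'] (T : ℕ) {p : K → ℝ} (hp : p ∈ stdSimplex ℝ K)
    {q : L → ℝ} (hq : q ∈ stdSimplex ℝ L) :
    ∃ v, Guarantees P Q g T p q v ∧ Defends P Q g T p q v := by
  refine exists_saddle (P.isCompact_nonRevealing p) ⟨_, P.uniformStrategy_mem hp⟩
    (Q.isCompact_nonRevealing q) ⟨_, Q.uniformStrategy_mem hq⟩ (continuous_total P Q g T p q) ?_ ?_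
  · intro σ₁ h₁ σ₂ h₂ a b ha hb hab
    obtain ⟨σ, hσ, h⟩ := exists_mix_mem (P := P) (Q := Q) (g := g) hp.1
      (w := fun e : Bool => cond e a b) (σ := fun e => cond e σ₁ σ₂) (by simp [ha, hb])
      (by simpa using hab) (by simp [h₁, h₂]) T q
    exact ⟨σ, hσ, fun τ _ => by simpa using h τ⟩
  · intro u hu w hw hw₁
    obtain ⟨τ, hτ, h⟩ := exists_mix_mem (P := Q) (Q := P) (g := fun l k h => -g k l h) hq.1 hw hw₁
      (σ := fun e : u => e) (fun e => hu e e.2) T p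
    refine ⟨τ, hτ, fun σ _ => ?_⟩
    have h := h σ
    simp_rw [total_swap, mul_neg, Finset.sum_neg_distrib] at h
    exact neg_injective h

/-- Splitting: the mixture acts as if the law were drawn between `p₁` and `p₂` with weights `a`,
`b`. Learning which one was drawn is harmless since both have the same limit law. -/
theorem Guarantees.concave {T : ℕ} {p₁ p₂ : K → ℝ} (hp₁ : ∀ k, 0 ≤ p₁ k) (hp₂ : ∀ k, 0 ≤ p₂ k)
    {q : L → ℝ} {v₁ v₂ : ℝ} (h₁ : Guarantees P Q g T p₁ q v₁) (h₂ : Guarantees P Q g T p₂ q v₂)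
    (hlim : p₁ ᵥ* P.lim = p₂ ᵥ* P.lim) {a b : ℝ} (ha : 0 ≤ a) (hb : 0 ≤ b) (hab : a + b = 1) :
    Guarantees P Q g T (a • p₁ + b • p₂) q (a * v₁ + b * v₂) := by
  obtain ⟨σ₁, hσ₁, h₁⟩ := h₁
  obtain ⟨σ₂, hσ₂, h₂⟩ := h₂
  let μ : Bool → K → ℝ := fun e => cond e (a • p₁) (b • p₂)
  let σ : Bool → Strategy H K A := fun e => cond e σ₁ σ₂
  have hμ : ∀ e k, 0 ≤ μ e k := by
    rintro (_ | _) k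
    exacts [mul_nonneg hb (hp₂ k), mul_nonneg ha (hp₁ k)]
  have hsum : ∑ e, μ e = a • p₁ + b • p₂ := by simp [μ]
  have hr : (a • p₁ + b • p₂) ᵥ* P.lim = p₁ ᵥ* P.lim := by
    rw [Matrix.add_vecMul, Matrix.smul_vecMul, Matrix.smul_vecMul, ← hlim, ← add_smul, hab,
      one_smul]
  refine ⟨P.mix μ σ, ?_, fun τ hτ => ?_⟩
  · rw [Side.nonRevealing, Set.mem_ofPred_eq, hr, ← hsum]
    refine Side.KeepsAt.mix hμ ?_
    rintro (_ | _)
    · rw [hlim]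
      exact hσ₂.smul b
    · exact hσ₁.smul a
  · rw [← hsum, total_mix P Q g hμ]
    simp only [Fintype.sum_bool, μ, σ, cond_true, cond_false, total_smul]
    exact add_le_add (mul_le_mul_of_nonneg_left (h₁ τ hτ) ha)
      (mul_le_mul_of_nonneg_left (h₂ τ hτ) hb)

theorem Defends.convex {T : ℕ} {p : K → ℝ} {q₁ q₂ : L → ℝ} (hq₁ : ∀ l, 0 ≤ q₁ l)
    (hq₂ : ∀ l, 0 ≤ q₂ l) {v₁ v₂ : ℝ} (h₁ : Defends P Q g T p q₁ v₁)
    (h₂ : Defends P Q g T p q₂ v₂) (hlim : q₁ ᵥ* Q.lim = q₂ ᵥ* Q.lim) {a b : ℝ} (ha : 0 ≤ a)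
    (hb : 0 ≤ b) (hab : a + b = 1) :
    Defends P Q g T p (a • q₁ + b • q₂) (a * v₁ + b * v₂) := by
  have h := (guarantees_swap.2 h₁).concave hq₁ hq₂ (guarantees_swap.2 h₂) hlim ha hb hab
  rw [mul_neg, mul_neg, ← neg_add] at h
  exact guarantees_swap.1 h

/-! ### The recursion -/

variable (P Q g) in
/-- The payoff of the first stage plus the expectation of `w` at the next beliefs. -/
noncomputable def stageValue (w : (K → ℝ) → (L → ℝ) → ℝ) (p : K → ℝ) (q : L → ℝ)
    (x : K → A → ℝ) (y : L → A' → ℝ) : ℝ :=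
  ∑ k, ∑ l, ∑ h, p k * q l * (x k (P.act h) * y l (Q.act h)) * g k l h +
    ∑ h, actionProb p x (P.act h) * actionProb q y (Q.act h) *
      w (bayes p x (P.act h) ᵥ* P.trans) (bayes q y (Q.act h) ᵥ* Q.trans)

theorem stageValue_swap {H K L A A' : Type*} [Fintype H] [Fintype K] [DecidableEq K] [Fintype L]
    [DecidableEq L] {P : Side H K A} {Q : Side H L A'} {g : K → L → H → ℝ} (w : (K → ℝ) → (L → ℝ) → ℝ) (p : K → ℝ) (q : L → ℝ)
    (x : K → A → ℝ) (y : L → A' → ℝ) :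
    stageValue Q P (fun l k h => -g k l h) (fun q p => -w p q) q p y x
      = -stageValue P Q g w p q x y := by
  simp only [stageValue, neg_add, ← Finset.sum_neg_distrib]
  rw [Finset.sum_comm]
  congr 1
  · refine Finset.sum_congr rfl fun k _ => Finset.sum_congr rfl fun l _ =>
      Finset.sum_congr rfl fun h _ => ?_
    ring
  · refine Finset.sum_congr rfl fun h _ => ?_
    ring

/-- After `x`, play an optimal strategy at the pair of next beliefs. That pair depends on `y`, hence
the restriction to opponents starting with `y`; their continuation averaged over the first state is
non-revealing by `mix_shift_mem`, so the guarantee applies to it. -/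
theorem exists_stageValue_le [Nonempty A] [Nonempty L] {T : ℕ} {w : (K → ℝ) → (L → ℝ) → ℝ}
    (hw : ∀ p ∈ stdSimplex ℝ K, ∀ q ∈ stdSimplex ℝ L, Guarantees P Q g T p q (w p q))
    {p : K → ℝ} (hp : p ∈ stdSimplex ℝ K) {q : L → ℝ} (hq : q ∈ stdSimplex ℝ L)
    {x : K → A → ℝ} (hx : x ∈ NR P.lim p) {y : L → A' → ℝ} (hy : y ∈ NR Q.lim q) :
    ∃ σ ∈ P.nonRevealing p, (∀ k, (σ.first k).1 = x k) ∧
      ∀ τ ∈ Q.nonRevealing q, (∀ l, (τ.first l).1 = y l) →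
        stageValue P Q g w p q x y ≤ total P Q g (T + 1) p q σ τ := by
  have hx0 : ∀ k a, 0 ≤ x k a := fun k => (hx.1 k).1
  have hy0 : ∀ l b, 0 ≤ y l b := fun l => (hy.1 l).1
  have hex : ∀ h, ∃ σ : Strategy H K A, (0 < actionProb p x (P.act h) →
      σ ∈ P.nonRevealing (bayes p x (P.act h) ᵥ* P.trans)) ∧
      (0 < actionProb p x (P.act h) → 0 < actionProb q y (Q.act h) →
        ∀ τ ∈ Q.nonRevealing (bayes q y (Q.act h) ᵥ* Q.trans),
          w (bayes p x (P.act h) ᵥ* P.trans) (bayes q y (Q.act h) ᵥ* Q.trans) ≤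
            total P Q g T (bayes p x (P.act h) ᵥ* P.trans) (bayes q y (Q.act h) ᵥ* Q.trans)
              σ τ) := by
    intro h
    by_cases h₁ : 0 < actionProb p x (P.act h)
    · have hp' := P.vecMul_trans_mem (bayes_mem hp.1 hx0 h₁)
      by_cases h₂ : 0 < actionProb q y (Q.act h)
      -- The continuation must be non-revealing even where only the opponent's action has
      -- probability 0; the uniform strategy serves there.
      · obtain ⟨σ, hσ, h⟩ := hw _ hp' _ (Q.vecMul_trans_mem (bayes_mem hq.1 hy0 h₂))
        exact ⟨σ, fun _ => hσ, fun _ _ => h⟩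
      · exact ⟨_, fun _ => P.uniformStrategy_mem hp', fun _ h => absurd h h₂⟩
    · exact ⟨uniformStrategy H K A, fun h => absurd h h₁, fun h => absurd h h₁⟩
  choose c hc hcw using hex
  refine ⟨Strategy.combine (fun k => ⟨x k, hx.1 k⟩) c, P.combine_mem hp hx hc, fun _ => rfl,
    fun τ hτ hτy => ?_⟩
  have hτ' : (fun l => (τ.first l).1) = y := funext hτy
  rw [total_succ, stageValue]
  simp only [Strategy.first_combine, Strategy.shift_combine, hτy]
  refine add_le_add le_rfl (Finset.sum_le_sum fun h _ => ?_)
  -- Bilinearity in the initial laws gathers the continuations over `(k, l)` into one game at the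
  -- next beliefs.
  have h₁ : ∑ l, q l * y l (Q.act h) * ∑ k, p k * x k (P.act h) *
      total P Q g T (P.row k) (Q.row l) (c h) (τ.shift h l) =
      actionProb p x (P.act h) * actionProb q y (Q.act h) *
        total P Q g T (bayes p x (P.act h) ᵥ* P.trans) (bayes q y (Q.act h) ᵥ* Q.trans) (c h)
          (Q.mix (fun l => (q l * y l (Q.act h)) • Q.row l) fun l => τ.shift h l) := by
    simp_rw [← total_sum_smul, ← total_smul_right]
    rw [← total_mix_right, P.sum_smul_row_actionProb hp.1 hx0,
      Q.sum_smul_row_actionProb hq.1 hy0, total_smul, total_smul_right, total_smul_right,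
      mul_assoc]
    exact fun l l' => mul_nonneg (mul_nonneg (hq.1 l) (hy0 l _)) (Q.row_nonneg l l')
  rw [h₁]
  rcases (actionProb_nonneg hp.1 hx0 (P.act h)).eq_or_lt with h₂ | h₂
  · rw [← h₂]
    simp
  rcases (actionProb_nonneg hq.1 hy0 (Q.act h)).eq_or_lt with h₃ | h₃
  · rw [← h₃]
    simp
  refine mul_le_mul_of_nonneg_left (hcw h h₂ h₃ _ ?_) (mul_pos h₂ h₃).le
  have h₄ := Q.mix_shift_mem hq.1 hτ h (by rwa [hτ'])
  simp only [hτ'] at h₄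
  simpa only [hτy] using h₄

theorem exists_le_stageValue [Nonempty A'] [Nonempty K] {T : ℕ} {w : (K → ℝ) → (L → ℝ) → ℝ}
    (hw : ∀ p ∈ stdSimplex ℝ K, ∀ q ∈ stdSimplex ℝ L, Defends P Q g T p q (w p q))
    {p : K → ℝ} (hp : p ∈ stdSimplex ℝ K) {q : L → ℝ} (hq : q ∈ stdSimplex ℝ L)
    {x : K → A → ℝ} (hx : x ∈ NR P.lim p) {y : L → A' → ℝ} (hy : y ∈ NR Q.lim q) :
    ∃ τ ∈ Q.nonRevealing q, (∀ l, (τ.first l).1 = y l) ∧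
      ∀ σ ∈ P.nonRevealing p, (∀ k, (σ.first k).1 = x k) →
        total P Q g (T + 1) p q σ τ ≤ stageValue P Q g w p q x y := by
  have h := exists_stageValue_le (P := Q) (Q := P) (g := fun l k h => -g k l h) (T := T)
    (w := fun q p => -w p q) (fun q hq p hp => guarantees_swap.2 (hw p hp q hq)) hq hp hy hx
  simpa only [stageValue_swap, total_swap, neg_le_neg_iff] using h

/-- For each non-revealing `x`, the minimum over the non-revealing `y` is attained. -/
theorem exists_min_stageValue [Nonempty A] [Nonempty A'] [Nonempty K] [Nonempty L] {T : ℕ}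
    {w : (K → ℝ) → (L → ℝ) → ℝ}
    (hw : ∀ p ∈ stdSimplex ℝ K, ∀ q ∈ stdSimplex ℝ L, Guarantees P Q g T p q (w p q))
    (hw' : ∀ p ∈ stdSimplex ℝ K, ∀ q ∈ stdSimplex ℝ L, Defends P Q g T p q (w p q))
    {p : K → ℝ} (hp : p ∈ stdSimplex ℝ K) {q : L → ℝ} (hq : q ∈ stdSimplex ℝ L)
    {x : K → A → ℝ} (hx : x ∈ NR P.lim p) :
    ∃ y ∈ NR Q.lim q, ∀ y' ∈ NR Q.lim q,
      stageValue P Q g w p q x y ≤ stageValue P Q g w p q x y' := by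
  -- The minimum is sought among strategies, since `w` is not known to be continuous: `τ` minimizes
  -- the best reply payoff over all `σ` starting with `x`, and `y` is its first action.
  let X : Set (Strategy H K A) := {σ | ∀ k a, (σ.first k).1 a = x k a} ∩ P.nonRevealing p
  have hX : IsCompact X := by
    refine (P.isCompact_nonRevealing p).inter_left ?_
    simp only [Set.ofPred_forall]
    exact isClosed_iInter fun k => isClosed_iInter fun a =>
      isClosed_eq (Strategy.continuous_first k a) continuous_const
  obtain ⟨τ, hτ, hmin⟩ := exists_min_upperBound hX (Q.isCompact_nonRevealing q)
    ⟨_, Q.uniformStrategy_mem hq⟩ (continuous_total P Q g (T + 1) p q)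
  refine ⟨fun l => (τ.first l).1, Q.first_mem_NR hq.1 hτ, fun y' hy' => ?_⟩
  obtain ⟨σ, hσ, hσx, hσv⟩ := exists_stageValue_le hw hp hq hx (Q.first_mem_NR hq.1 hτ)
  obtain ⟨τ', hτ', -, hτv⟩ := exists_le_stageValue hw' hp hq hx hy'
  -- The stage value at `y` is at most the payoff of `σ` against `τ`, hence at most any bound that
  -- `τ'` enforces on `X`, in particular the stage value at `y'`.
  exact (hσv τ hτ fun _ => rfl).trans (hmin τ' hτ' _
    (fun σ' hσ' => hτv σ' hσ'.2 fun k => funext (hσ'.1 k)) σ ⟨fun k a => congrFun (hσx k) a, hσ⟩)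

theorem exists_max_stageValue [Nonempty A] [Nonempty A'] [Nonempty K] [Nonempty L] {T : ℕ}
    {w : (K → ℝ) → (L → ℝ) → ℝ}
    (hw : ∀ p ∈ stdSimplex ℝ K, ∀ q ∈ stdSimplex ℝ L, Guarantees P Q g T p q (w p q))
    (hw' : ∀ p ∈ stdSimplex ℝ K, ∀ q ∈ stdSimplex ℝ L, Defends P Q g T p q (w p q))
    {p : K → ℝ} (hp : p ∈ stdSimplex ℝ K) {q : L → ℝ} (hq : q ∈ stdSimplex ℝ L)
    {y : L → A' → ℝ} (hy : y ∈ NR Q.lim q) :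
    ∃ x ∈ NR P.lim p, ∀ x' ∈ NR P.lim p,
      stageValue P Q g w p q x' y ≤ stageValue P Q g w p q x y := by
  have h := exists_min_stageValue (P := Q) (Q := P) (g := fun l k h => -g k l h) (T := T)
    (w := fun q p => -w p q) (fun q hq p hp => guarantees_swap.2 (hw' p hp q hq))
    (fun q hq p hp => defends_swap.2 (hw p hp q hq)) hq hp hy
  simpa only [stageValue_swap, neg_le_neg_iff] using h

/-- An optimal non-revealing strategy begins with an optimal non-revealing one-stage action. -/
theorem exists_forall_le_stageValue [Nonempty A'] [Nonempty K] {T : ℕ}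
    {w : (K → ℝ) → (L → ℝ) → ℝ}
    (hw : ∀ p ∈ stdSimplex ℝ K, ∀ q ∈ stdSimplex ℝ L, Defends P Q g T p q (w p q))
    {p : K → ℝ} (hp : p ∈ stdSimplex ℝ K) {q : L → ℝ} (hq : q ∈ stdSimplex ℝ L) {v : ℝ}
    (hv : Guarantees P Q g (T + 1) p q v) :
    ∃ x ∈ NR P.lim p, ∀ y ∈ NR Q.lim q, v ≤ stageValue P Q g w p q x y := by
  obtain ⟨σ, hσ, h⟩ := hv
  refine ⟨fun k => (σ.first k).1, P.first_mem_NR hp.1 hσ, fun y hy => ?_⟩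
  obtain ⟨τ, hτ, -, h'⟩ := exists_le_stageValue hw hp hq (P.first_mem_NR hp.1 hσ) hy
  exact (h τ hτ).trans (h' σ hσ fun _ => rfl)

theorem exists_forall_stageValue_le [Nonempty A] [Nonempty L] {T : ℕ}
    {w : (K → ℝ) → (L → ℝ) → ℝ}
    (hw : ∀ p ∈ stdSimplex ℝ K, ∀ q ∈ stdSimplex ℝ L, Guarantees P Q g T p q (w p q))
    {p : K → ℝ} (hp : p ∈ stdSimplex ℝ K) {q : L → ℝ} (hq : q ∈ stdSimplex ℝ L) {v : ℝ}
    (hv : Defends P Q g (T + 1) p q v) :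
    ∃ y ∈ NR Q.lim q, ∀ x ∈ NR P.lim p, stageValue P Q g w p q x y ≤ v := by
  obtain ⟨τ, hτ, h⟩ := hv
  refine ⟨fun l => (τ.first l).1, Q.first_mem_NR hq.1 hτ, fun x hx => ?_⟩
  obtain ⟨σ, hσ, -, h'⟩ := exists_stageValue_le hw hp hq hx (Q.first_mem_NR hq.1 hτ)
  exact (h' τ hτ fun _ => rfl).trans (h σ hσ)

end Game

/-! ### Attained optima -/

/-- The last two hypotheses give a saddle point of value `v`; the first two are needed since inner
optima must be attained at every point, not only at the saddle. -/
theorem isMaxMin_and_isMinMax {α β : Type*} {X : Set α} {Y : Set β} {f : α → β → ℝ} {v : ℝ}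
    (hmin : ∀ x ∈ X, ∃ y ∈ Y, ∀ y' ∈ Y, f x y ≤ f x y')
    (hmax : ∀ y ∈ Y, ∃ x ∈ X, ∀ x' ∈ X, f x' y ≤ f x y)
    (hX : ∃ x ∈ X, ∀ y ∈ Y, v ≤ f x y) (hY : ∃ y ∈ Y, ∀ x ∈ X, f x y ≤ v) :
    IsMaxMin X Y f v ∧ IsMinMax X Y f v := by
  obtain ⟨x₀, hx₀, hx⟩ := hX
  obtain ⟨y₀, hy₀, hy⟩ := hY
  have hv : f x₀ y₀ = v := le_antisymm (hy x₀ hx₀) (hx y₀ hy₀)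
  have h₁ : ∀ x ∈ X, IsLeast ((fun y => f x y) '' Y) (sInf ((fun y => f x y) '' Y)) := by
    intro x hx
    obtain ⟨y, hy, h⟩ := hmin x hx
    have h' : IsLeast ((fun y => f x y) '' Y) (f x y) :=
      ⟨⟨y, hy, rfl⟩, by rintro _ ⟨y', hy', rfl⟩; exact h y' hy'⟩
    rwa [h'.csInf_eq]
  have h₂ : ∀ y ∈ Y, IsGreatest ((fun x => f x y) '' X) (sSup ((fun x => f x y) '' X)) := by
    intro y hy
    obtain ⟨x, hx, h⟩ := hmax y hy
    have h' : IsGreatest ((fun x => f x y) '' X) (f x y) :=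
      ⟨⟨x, hx, rfl⟩, by rintro _ ⟨x', hx', rfl⟩; exact h x' hx'⟩
    rwa [h'.csSup_eq]
  refine ⟨⟨_, h₁, ⟨x₀, hx₀, ?_⟩, ?_⟩, ⟨_, h₂, ⟨y₀, hy₀, ?_⟩, ?_⟩⟩
  · refine IsLeast.csInf_eq ⟨⟨y₀, hy₀, hv⟩, ?_⟩
    rintro _ ⟨y, hy, rfl⟩
    exact hx y hy
  · rintro _ ⟨x, hx, rfl⟩
    exact ((h₁ x hx).2 ⟨y₀, hy₀, rfl⟩).trans (hy x hx)
  · refine IsGreatest.csSup_eq ⟨⟨x₀, hx₀, hv⟩, ?_⟩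
    rintro _ ⟨x, hx, rfl⟩
    exact hy x hx
  · rintro _ ⟨y, hy, rfl⟩
    exact (hx y hy).trans ((h₂ y hy).2 ⟨x₀, hx₀, rfl⟩)

theorem iSup_iInf_eq {α β : Type*} {X : Set α} {Y : Set β} {f : α → β → ℝ} {v : ℝ}
    (h : IsMaxMin X Y f v) : ⨆ x : X, ⨅ y : Y, f x y = v := by
  obtain ⟨m, hm, hv⟩ := h
  have h₁ : ∀ x : X, ⨅ y : Y, f x y = m x := fun x => by
    rw [← (hm x x.2).csInf_eq, Set.image_eq_range, iInf]
  simp_rw [h₁]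
  rw [← hv.csSup_eq, Set.image_eq_range, iSup]

end MarkovGames

namespace MarkovGame

theorem sum_first_mul_first {K L I J : Type*} [Fintype I] [Fintype J] (σ : Strategy (I × J) K I) (τ : Strategy (I × J) L J) (k : K)
    (l : L) : ∑ h : I × J, (σ.first k).1 h.1 * (τ.first l).1 h.2 = 1 := by
  rw [Fintype.sum_prod_type]
  simp_rw [← Finset.mul_sum, (τ.first l).2.2, mul_one]
  exact (σ.first k).2.2

theorem actions_cons_eq_iff {K L I J : Type*} {T : ℕ} (x : K × L × I × J) (ω : Fin T → K × L × I × J)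
    (h : Fin (T + 1) → I × J) :
    actions (Fin.cons x ω : Fin (T + 1) → _) = h ↔ x.2.2 = h 0 ∧ actions ω = Fin.tail h := by
  rw [funext_iff, Fin.forall_fin_succ, funext_iff]
  rfl

/-- Separates the sums of the two independent chains in the induction of `sum_playProb_ite`. -/
theorem sum_sum_mul_sum_sum {K L : Type*} [Fintype K] [Fintype L] (u : K → ℝ) (v : L → ℝ) (φ : K → L → ℝ) (b : K → K → ℝ)
    (c : L → L → ℝ) :
    ∑ k, ∑ l, u k * v l * ∑ k', ∑ l', φ k' l' * (b k k' * c l l') =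
      ∑ k', ∑ l', φ k' l' * ((∑ k, u k * b k k') * ∑ l, v l * c l l') := by
  simp_rw [Finset.sum_mul_sum, Finset.mul_sum, ← Fintype.sum_prod_type']
  refine Fintype.sum_equiv ⟨fun z => (z.2.2.1, z.2.2.2, z.1, z.2.1),
    fun z => (z.2.2.1, z.2.2.2, z.1, z.2.1), fun _ => rfl, fun _ => rfl⟩ _ _ fun z => ?_
  simp only [Equiv.coe_fn_mk]
  ring

variable {K L I J : Type*} [Fintype K] [Fintype L] [Fintype I] [Fintype J]
  [DecidableEq K] [DecidableEq L]

/-! ### The game as a pair of sides -/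

/-- The data of the first player. -/
@[simps] noncomputable def side₁ [Nonempty J] (G : MarkovGame K L I J) (h : G.M * G.B = G.B) :
    Side (I × J) K I where
  act := Prod.fst
  trans := G.M
  lim := G.B
  act_surjective := Prod.fst_surjective
  trans_mem := G.M_mem
  trans_mul_lim := h

/-- The data of the second player. -/
@[simps] noncomputable def side₂ [Nonempty I] (G : MarkovGame K L I J) (h : G.N * G.C = G.C) :
    Side (I × J) L J where
  act := Prod.snd
  trans := G.N
  lim := G.C
  act_surjective := Prod.snd_surjective
  trans_mem := G.N_mem
  trans_mul_lim := h

theorem sum_fin_succ {X R : Type*} [Fintype X] [AddCommMonoid R] {t : ℕ}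
    (f : (Fin (t + 1) → X) → R) :
    ∑ ω, f ω = ∑ x, ∑ ω : Fin t → X, f (Fin.cons x ω) := by
  rw [← (Fin.consEquiv fun _ : Fin (t + 1) => X).sum_comp, Fintype.sum_prod_type]
  rfl

theorem take_succ_cons {X : Type*} {t : ℕ} (a : X) (v : Fin t → X) (n : ℕ) (hn : n ≤ t) :
    Fin.take (n + 1) (Nat.succ_le_succ hn) (Fin.cons a v : Fin (t + 1) → X)
      = Fin.cons a (Fin.take n hn v) :=
  funext (Fin.cases rfl fun _ => rfl)

theorem take_one_cons {X : Type*} {t : ℕ} (a : X) (v : Fin t → X) :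
    Fin.take 1 (Nat.succ_le_succ (Nat.zero_le t)) (Fin.cons a v : Fin (t + 1) → X) = fun _ => a :=
  funext (Fin.cases rfl fun i => i.elim0)

theorem chainProb_cons {S : Type*} (p : S → ℝ) (M : Matrix S S ℝ) {t : ℕ} (k : S)
    (s : Fin t → S) :
    chainProb p M (Fin.cons k s : Fin (t + 1) → S) = p k * chainProb (fun k' => M k k') M s := by
  cases t with
  | zero => simp [chainProb]
  | succ t =>
    simp only [chainProb, Fin.prod_univ_succ (n := t)]
    rfl

/-! ### Probabilities of histories, beliefs and payoffs -/

section Sides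

variable [Nonempty I] [Nonempty J] (G : MarkovGame K L I J) (hM : G.M * G.B = G.B)
  (hN : G.N * G.C = G.C)

/-- Given the first stage, the rest is a play of the same game started from the rows of the current
states, with shifted strategies. -/
theorem playProb_cons (p : K → ℝ) (q : L → ℝ)
    (σ : Strategy (I × J) K I) (τ : Strategy (I × J) L J) {t : ℕ} (x : K × L × I × J)
    (ω : Fin t → K × L × I × J) :
    G.playProb p q σ τ (Fin.cons x ω : Fin (t + 1) → K × L × I × J) =
      p x.1 * q x.2.1 * ((σ.first x.1).1 x.2.2.1 * (τ.first x.2.1).1 x.2.2.2) *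
        G.playProb ((G.side₁ hM).row x.1) ((G.side₂ hN).row x.2.1) (σ.shift x.2.2 x.1)
          (τ.shift x.2.2 x.2.1) ω := by
  have hk : kStates (Fin.cons x ω : Fin (t + 1) → K × L × I × J) = Fin.cons x.1 (kStates ω) :=
    funext (Fin.cases rfl fun _ => rfl)
  have hl : lStates (Fin.cons x ω : Fin (t + 1) → K × L × I × J) = Fin.cons x.2.1 (lStates ω) :=
    funext (Fin.cases rfl fun _ => rfl)
  have hck : chainProb p G.M (kStates (Fin.cons x ω : Fin (t + 1) → K × L × I × J)) =
      p x.1 * chainProb ((G.side₁ hM).row x.1) G.M (kStates ω) := by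
    rw [hk]
    exact chainProb_cons _ _ _ _
  have hcl : chainProb q G.N (lStates (Fin.cons x ω : Fin (t + 1) → K × L × I × J)) =
      q x.2.1 * chainProb ((G.side₂ hN).row x.2.1) G.N (lStates ω) := by
    rw [hl]
    exact chainProb_cons _ _ _ _
  have ha : actions (Fin.cons x ω : Fin (t + 1) → K × L × I × J) = Fin.cons x.2.2 (actions ω) :=
    funext (Fin.cases rfl fun _ => rfl)
  have h0 : ((σ 0 (Fin.take 0 (Nat.zero_le _) (actions (Fin.cons x ω : Fin (t + 1) → _)))
      (Fin.take 1 (Nat.succ_le_succ (Nat.zero_le t)) (kStates (Fin.cons x ω)))).1 x.2.2.1 *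
      (τ 0 (Fin.take 0 (Nat.zero_le _) (actions (Fin.cons x ω : Fin (t + 1) → _)))
      (Fin.take 1 (Nat.succ_le_succ (Nat.zero_le t)) (lStates (Fin.cons x ω)))).1 x.2.2.2) =
      (σ.first x.1).1 x.2.2.1 * (τ.first x.2.1).1 x.2.2.2 := by
    rw [hk, hl, take_one_cons, take_one_cons, Subsingleton.elim (Fin.take 0 _ _) Fin.elim0]
    rfl
  have hs : ∀ s : Fin t,
      ((σ (s + 1) (Fin.take (s + 1) (Nat.succ_le_succ s.isLt.le)
          (actions (Fin.cons x ω : Fin (t + 1) → _)))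
        (Fin.take (s + 1 + 1) (Nat.succ_le_succ s.isLt) (kStates (Fin.cons x ω)))).1
          (actions ω s).1 *
      (τ (s + 1) (Fin.take (s + 1) (Nat.succ_le_succ s.isLt.le)
          (actions (Fin.cons x ω : Fin (t + 1) → _)))
        (Fin.take (s + 1 + 1) (Nat.succ_le_succ s.isLt) (lStates (Fin.cons x ω)))).1
          (actions ω s).2) =
      ((σ.shift x.2.2 x.1 s (Fin.take s s.isLt.le (actions ω))
        (Fin.take (s + 1) s.isLt (kStates ω))).1 (actions ω s).1 *
       (τ.shift x.2.2 x.2.1 s (Fin.take s s.isLt.le (actions ω))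
        (Fin.take (s + 1) s.isLt (lStates ω))).1 (actions ω s).2) := by
    intro s
    rw [hk, hl, ha, take_succ_cons, take_succ_cons, take_succ_cons]
    rfl
  have hprod := Finset.prod_congr (rfl : (Finset.univ : Finset (Fin t)) = _) fun s _ => hs s
  unfold playProb
  rw [Fin.prod_univ_succ]
  refine (congrArg₂ _ rfl (congrArg₂ _ h0 hprod)).trans ?_
  rw [hck, hcl]
  ring

theorem sum_playProb_succ (p : K → ℝ) (q : L → ℝ) (σ : Strategy (I × J) K I)
    (τ : Strategy (I × J) L J) {t : ℕ} (f : (Fin (t + 1) → K × L × I × J) → ℝ) :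
    ∑ ω, G.playProb p q σ τ ω * f ω = ∑ k, ∑ l, ∑ h : I × J,
      p k * q l * ((σ.first k).1 h.1 * (τ.first l).1 h.2) * ∑ ω : Fin t → K × L × I × J,
        G.playProb ((G.side₁ hM).row k) ((G.side₂ hN).row l) (σ.shift h k) (τ.shift h l) ω *
          f (Fin.cons (k, l, h) ω) := by
  rw [sum_fin_succ]
  simp_rw [Fintype.sum_prod_type (α₁ := K), Fintype.sum_prod_type (α₁ := L),
    G.playProb_cons hM hN, mul_assoc, ← Finset.mul_sum]

include hM hN in
theorem sum_playProb {p : K → ℝ} (hp : p ∈ stdSimplex ℝ K) {q : L → ℝ} (hq : q ∈ stdSimplex ℝ L)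
    (σ : Strategy (I × J) K I) (τ : Strategy (I × J) L J) (t : ℕ) :
    ∑ ω : Fin t → K × L × I × J, G.playProb p q σ τ ω = 1 := by
  induction t generalizing p q σ τ with
  | zero => simp [playProb, chainProb]
  | succ t ih =>
    have h := G.sum_playProb_succ hM hN p q σ τ (t := t) fun _ => 1
    simp_rw [mul_one, ih ((G.side₁ hM).row_mem _) ((G.side₂ hN).row_mem _), mul_one,
      ← Finset.mul_sum, sum_first_mul_first, mul_one, ← Finset.mul_sum, hq.2, mul_one] at h
    rw [h, hp.2]

theorem sum_playProb_mul_payoff {p : K → ℝ} (hp : p ∈ stdSimplex ℝ K) {q : L → ℝ}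
    (hq : q ∈ stdSimplex ℝ L) (σ : Strategy (I × J) K I) (τ : Strategy (I × J) L J) (T : ℕ) :
    ∑ ω : Fin T → K × L × I × J, G.playProb p q σ τ ω *
        ∑ s, G.g (ω s).1 (ω s).2.1 (ω s).2.2.1 (ω s).2.2.2 =
      total (G.side₁ hM) (G.side₂ hN) (fun k l h => G.g k l h.1 h.2) T p q σ τ := by
  induction T generalizing p q σ τ with
  | zero => simp [total]
  | succ t ih =>
    rw [G.sum_playProb_succ hM hN]
    simp only [Fin.sum_univ_succ, Fin.cons_zero, Fin.cons_succ, mul_add, Finset.sum_add_distrib,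
      ← Finset.sum_mul, G.sum_playProb hM hN ((G.side₁ hM).row_mem _) ((G.side₂ hN).row_mem _),
      ih ((G.side₁ hM).row_mem _) ((G.side₂ hN).row_mem _), one_mul, total, side₁_act, side₂_act]

theorem payoff_eq (T : ℕ) {p : K → ℝ} (hp : p ∈ stdSimplex ℝ K) {q : L → ℝ}
    (hq : q ∈ stdSimplex ℝ L) (σ : Strategy (I × J) K I) (τ : Strategy (I × J) L J) :
    G.payoff T p q σ τ = 1 / (T : ℝ) *
      total (G.side₁ hM) (G.side₂ hN) (fun k l h => G.g k l h.1 h.2) T p q σ τ := by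
  rw [payoff, ← G.sum_playProb_mul_payoff hM hN hp hq, Finset.mul_sum]
  exact Finset.sum_congr rfl fun ω _ => mul_left_comm _ _ _

theorem shapley_eq_stageValue (T : ℕ) (f : (K → ℝ) → (L → ℝ) → ℝ) (p : K → ℝ) (q : L → ℝ)
    (x : K → I → ℝ) (y : L → J → ℝ) :
    G.shapley T f p q x y = stageValue (G.side₁ hM) (G.side₂ hN)
      (fun k l h => G.g k l h.1 h.2) (fun p q => T * f p q) p q x y := by
  simp only [shapley, stagePayoff, stageValue, Fintype.sum_prod_type, side₁_act, side₂_act,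
    side₁_trans, side₂_trans, Finset.mul_sum, mul_assoc, mul_left_comm (T : ℝ)]

variable [DecidableEq I] [DecidableEq J]

theorem sum_playProb_succ_of_first (p : K → ℝ) (q : L → ℝ) (σ : Strategy (I × J) K I)
    (τ : Strategy (I × J) L J) {t : ℕ} {f : (Fin (t + 1) → K × L × I × J) → ℝ}
    {f' : (Fin t → K × L × I × J) → ℝ} {h : I × J}
    (hf : ∀ x ω, f (Fin.cons x ω) = if x.2.2 = h then f' ω else 0) :
    ∑ ω, G.playProb p q σ τ ω * f ω = ∑ k, ∑ l,
      (p k * (σ.first k).1 h.1) * (q l * (τ.first l).1 h.2) * ∑ ω : Fin t → K × L × I × J,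
        G.playProb ((G.side₁ hM).row k) ((G.side₂ hN).row l) (σ.shift h k) (τ.shift h l) ω *
          f' ω := by
  rw [G.sum_playProb_succ hM hN]
  refine Finset.sum_congr rfl fun k _ => Finset.sum_congr rfl fun l _ => ?_
  rw [Finset.sum_eq_single h]
  · simp only [hf, if_true]
    ring
  · intro h' _ hne
    simp [hf, hne]
  · simp

/-- For a fixed history, each player's choices depend only on his own chain, so the sum over state
paths factors. -/
theorem historyProb_eq {p : K → ℝ} (hp : p ∈ stdSimplex ℝ K) {q : L → ℝ}
    (hq : q ∈ stdSimplex ℝ L) (σ : Strategy (I × J) K I) (τ : Strategy (I × J) L J) {T : ℕ}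
    (h : Fin T → I × J) : G.historyProb p q σ τ h =
      (∑ k, (G.side₁ hM).bel T p σ h k) * ∑ l, (G.side₂ hN).bel T q τ h l := by
  have hist : ∀ (t : ℕ) (h : Fin t → I × J) (p : K → ℝ) (q : L → ℝ) σ τ,
      G.historyProb p q σ τ h = ∑ ω : Fin t → K × L × I × J,
        G.playProb p q σ τ ω * if actions ω = h then 1 else 0 := fun t h p q σ τ => by
    simp [historyProb]
  induction T generalizing p q σ τ with
  | zero =>
    simp [historyProb, Side.bel, hp.2, hq.2, playProb, chainProb, eq_iff_true_of_subsingleton]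
  | succ T ih =>
    rw [hist, G.sum_playProb_succ_of_first hM hN p q σ τ
      (f' := fun ω => if actions ω = Fin.tail h then 1 else 0) (h := h 0)
      fun x ω => by rw [if_congr (actions_cons_eq_iff x ω h) rfl rfl, ite_and]]
    simp only [Side.bel, Finset.sum_apply, Pi.smul_apply, smul_eq_mul, ← hist,
      ih ((G.side₁ hM).row_mem _) ((G.side₂ hN).row_mem _)]
    rw [Finset.sum_comm (s := (Finset.univ : Finset K)) (t := (Finset.univ : Finset K)),
      Finset.sum_comm (s := (Finset.univ : Finset L)) (t := (Finset.univ : Finset L)),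
      Finset.sum_mul_sum]
    refine Finset.sum_congr rfl fun k _ => Finset.sum_congr rfl fun l _ => ?_
    rw [← Finset.mul_sum, ← Finset.mul_sum]
    exact mul_mul_mul_comm _ _ _ _

/-- The joint law of the states of stage `T + 1` and the history of the first `T` stages. -/
theorem sum_playProb_ite (p : K → ℝ) (q : L → ℝ) (σ : Strategy (I × J) K I)
    (τ : Strategy (I × J) L J) {T : ℕ} (h : Fin T → I × J) (φ : K → L → ℝ) :
    ∑ ω : Fin (T + 1) → K × L × I × J, G.playProb p q σ τ ω *
      (if actions (Fin.init ω) = h then φ (ω (Fin.last T)).1 (ω (Fin.last T)).2.1 else 0) =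
      ∑ k, ∑ l, φ k l * ((G.side₁ hM).bel T p σ h k * (G.side₂ hN).bel T q τ h l) := by
  induction T generalizing p q σ τ with
  | zero =>
    rw [G.sum_playProb_succ hM hN]
    refine Finset.sum_congr rfl fun k _ => Finset.sum_congr rfl fun l _ => ?_
    have h₁ : ∀ (p : K → ℝ) (q : L → ℝ) σ τ h',
        ∑ ω : Fin 0 → K × L × I × J, G.playProb p q σ τ ω *
          (if actions (Fin.init (Fin.cons (k, l, h') ω : Fin 1 → K × L × I × J)) = h then
            φ ((Fin.cons (k, l, h') ω : Fin 1 → K × L × I × J) (Fin.last 0)).1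
              ((Fin.cons (k, l, h') ω : Fin 1 → K × L × I × J) (Fin.last 0)).2.1 else 0) =
          φ k l := by
      intro p q σ τ h'
      rw [Fintype.sum_unique, if_pos (Subsingleton.elim _ _)]
      simp [playProb, chainProb]
    simp_rw [h₁, ← Finset.sum_mul, ← Finset.mul_sum, sum_first_mul_first, Side.bel]
    ring
  | succ T ih =>
    rw [G.sum_playProb_succ_of_first hM hN p q σ τ
      (f' := fun ω => if actions (Fin.init ω) = Fin.tail h then
        φ (ω (Fin.last T)).1 (ω (Fin.last T)).2.1 else 0) (h := h 0)]
    · simp only [ih, Side.bel, Finset.sum_apply, Pi.smul_apply, smul_eq_mul]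
      exact sum_sum_mul_sum_sum _ _ _ _ _
    · intro x ω
      have h₁ : actions (Fin.init (Fin.cons x ω : Fin (T + 2) → K × L × I × J)) = h ↔
          x.2.2 = h 0 ∧ actions (Fin.init ω) = Fin.tail h := by
        rw [funext_iff, Fin.forall_fin_succ, funext_iff]
        rfl
      rw [if_congr h₁ rfl rfl, ite_and]
      rfl

include hN in
-- The second player's factor cancels from the quotient: the belief on `K` depends on neither `q`
-- nor `τ`.
theorem kBelief_eq {p : K → ℝ} (hp : p ∈ stdSimplex ℝ K) {q : L → ℝ} (hq : q ∈ stdSimplex ℝ L)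
    (σ : Strategy (I × J) K I) (τ : Strategy (I × J) L J) {T : ℕ} {h : Fin T → I × J}
    (h0 : 0 < G.historyProb p q σ τ h) : G.kBelief p q σ τ h =
      (∑ k, (G.side₁ hM).bel T p σ h k)⁻¹ • (G.side₁ hM).bel T p σ h := by
  funext k
  have h₁ := G.sum_playProb_ite hM hN p q σ τ h fun k' _ => if k' = k then 1 else 0
  rw [G.historyProb_eq hM hN hp hq] at h0
  have h₂ := right_ne_zero_of_mul h0.ne'
  simp only [← ite_and, mul_ite, mul_one, mul_zero, ite_mul, one_mul, zero_mul] at h₁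
  rw [kBelief, h₁, G.historyProb_eq hM hN hp hq]
  simp only [Finset.sum_ite_irrel, Finset.sum_const_zero, Finset.sum_ite_eq', Finset.mem_univ,
    if_true, ← Finset.mul_sum, Pi.smul_apply, smul_eq_mul]
  rw [mul_div_mul_right _ _ h₂, div_eq_inv_mul]

include hM in
theorem lBelief_eq {p : K → ℝ} (hp : p ∈ stdSimplex ℝ K) {q : L → ℝ} (hq : q ∈ stdSimplex ℝ L)
    (σ : Strategy (I × J) K I) (τ : Strategy (I × J) L J) {T : ℕ} {h : Fin T → I × J}
    (h0 : 0 < G.historyProb p q σ τ h) : G.lBelief p q σ τ h =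
      (∑ l, (G.side₂ hN).bel T q τ h l)⁻¹ • (G.side₂ hN).bel T q τ h := by
  funext l
  have h₁ := G.sum_playProb_ite hM hN p q σ τ h fun _ l' => if l' = l then 1 else 0
  rw [G.historyProb_eq hM hN hp hq] at h0
  have h₂ := left_ne_zero_of_mul h0.ne'
  simp only [← ite_and, mul_ite, mul_one, mul_zero, ite_mul, one_mul, zero_mul] at h₁
  rw [lBelief, h₁, G.historyProb_eq hM hN hp hq]
  simp only [Finset.sum_ite_eq', Finset.mem_univ, if_true, ← Finset.sum_mul, Pi.smul_apply,
    smul_eq_mul]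
  rw [mul_div_mul_left _ _ h₂, div_eq_inv_mul]

end Sides

end MarkovGame

/-! ### Identification of the two notions of non-revealing strategy, and the value -/

namespace MarkovGames

theorem Side.normalized_vecMul_eq_iff {H S A : Type*} [Fintype S] [DecidableEq S] [Fintype A]
    (P : Side H S A) {p r : S → ℝ} {σ : Strategy H S A} {t : ℕ} {h : Fin t → H}
    (h0 : ∑ k, P.bel t p σ h k ≠ 0) :
    ((∑ k, P.bel t p σ h k)⁻¹ • P.bel t p σ h) ᵥ* P.lim = r ↔
      P.bel t p σ h ᵥ* P.lim = (∑ k, P.bel t p σ h k) • r := by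
  rw [Matrix.smul_vecMul, inv_smul_eq_iff₀ h0]

theorem Side.keepsAt_of_pos {H S A : Type*} [Fintype S] [DecidableEq S] [Fintype A]
    {P : Side H S A} {p r : S → ℝ} (hp : ∀ k, 0 ≤ p k) {σ : Strategy H S A}
    (h : ∀ (t : ℕ) (h : Fin t → H), 0 < ∑ k, P.bel t p σ h k →
      P.bel t p σ h ᵥ* P.lim = (∑ k, P.bel t p σ h k) • r) : P.KeepsAt r p σ := by
  intro t h'
  have hb := P.bel_nonneg hp t σ h'
  rcases (Finset.sum_nonneg fun k _ => hb k).eq_or_lt with h0 | h0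
  · have h₁ : P.bel t p σ h' = 0 := funext fun k =>
      (Finset.sum_eq_zero_iff_of_nonneg fun k _ => hb k).1 h0.symm k (Finset.mem_univ k)
    rw [← h0, h₁, Matrix.zero_vecMul, zero_smul]
  · exact h t h' h0

end MarkovGames

namespace MarkovGame

variable {K L I J : Type*} [Fintype K] [Fintype L] [Fintype I] [Fintype J]
  [DecidableEq K] [DecidableEq L] [DecidableEq I] [DecidableEq J]
  [Nonempty I] [Nonempty J] (G : MarkovGame K L I J)
  (hM : G.M * G.B = G.B) (hN : G.N * G.C = G.C)

include hN in
-- A single opponent suffices as a test: uniform play from a point mass, under which a history is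
-- possible exactly when the first player's own factor is positive.
theorem nonRevealing₁_eq [Nonempty L] {p : K → ℝ} (hp : p ∈ stdSimplex ℝ K) :
    G.nonRevealing₁ p = (G.side₁ hM).nonRevealing p := by
  ext σ
  constructor
  · intro hσ
    refine Side.keepsAt_of_pos hp.1 fun t h h0 => ?_
    have hq := single_mem_stdSimplex ℝ (Classical.arbitrary L)
    have hpos : 0 < G.historyProb p (Pi.single (Classical.arbitrary L) 1) σ (uniformStrategy (I × J) L J) h := by
      rw [G.historyProb_eq hM hN hp hq]
      exact mul_pos h0 ((G.side₂ hN).sum_bel_uniformStrategy_pos hq t h)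
    have h₁ := hσ _ hq _ t h hpos
    rw [G.kBelief_eq hM hN hp hq _ _ hpos] at h₁
    exact ((G.side₁ hM).normalized_vecMul_eq_iff h0.ne').1 h₁
  · intro hσ q hq τ t h h0
    have h₁ := h0
    rw [G.historyProb_eq hM hN hp hq] at h₁
    rw [G.kBelief_eq hM hN hp hq _ _ h0]
    exact ((G.side₁ hM).normalized_vecMul_eq_iff (left_ne_zero_of_mul h₁.ne')).2 (hσ t h)

include hM in
theorem nonRevealing₂_eq [Nonempty K] {q : L → ℝ} (hq : q ∈ stdSimplex ℝ L) :
    G.nonRevealing₂ q = (G.side₂ hN).nonRevealing q := by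
  ext τ
  constructor
  · intro hτ
    refine Side.keepsAt_of_pos hq.1 fun t h h0 => ?_
    have hp := single_mem_stdSimplex ℝ (Classical.arbitrary K)
    have hpos : 0 < G.historyProb (Pi.single (Classical.arbitrary K) 1) q (uniformStrategy (I × J) K I) τ h := by
      rw [G.historyProb_eq hM hN hp hq]
      exact mul_pos ((G.side₁ hM).sum_bel_uniformStrategy_pos hp t h) h0
    have h₁ := hτ _ hp _ t h hpos
    rw [G.lBelief_eq hM hN hp hq _ _ hpos] at h₁
    exact ((G.side₂ hN).normalized_vecMul_eq_iff h0.ne').1 h₁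
  · intro hτ p hp σ t h h0
    have h₁ := h0
    rw [G.historyProb_eq hM hN hp hq] at h₁
    rw [G.lBelief_eq hM hN hp hq _ _ h0]
    exact ((G.side₂ hN).normalized_vecMul_eq_iff (right_ne_zero_of_mul h₁.ne')).2 (hτ t h)

include hM hN in
-- Besides the value of the average payoff, it records `T` times that value as the value of the
-- total payoff, the form used in the recursion.
theorem value_spec [Nonempty K] [Nonempty L] (T : ℕ) {p : K → ℝ} (hp : p ∈ stdSimplex ℝ K) {q : L → ℝ}
    (hq : q ∈ stdSimplex ℝ L) :
    (IsMaxMin (G.nonRevealing₁ p) (G.nonRevealing₂ q) (G.payoff T p q) (G.nrValue T p q) ∧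
      IsMinMax (G.nonRevealing₁ p) (G.nonRevealing₂ q) (G.payoff T p q) (G.nrValue T p q)) ∧
    Guarantees (G.side₁ hM) (G.side₂ hN) (fun k l h => G.g k l h.1 h.2) T p q
      (T * G.nrValue T p q) ∧
    Defends (G.side₁ hM) (G.side₂ hN) (fun k l h => G.g k l h.1 h.2) T p q
      (T * G.nrValue T p q) := by
  set P := G.side₁ hM
  set Q := G.side₂ hN
  set g : K → L → I × J → ℝ := fun k l h => G.g k l h.1 h.2
  obtain ⟨v, hv, hv'⟩ := exists_value (P := P) (Q := Q) (g := g) T hp hq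
  have hT : (0 : ℝ) ≤ 1 / T := by positivity
  have hcont := continuous_total P Q g T p q
  have hpay : G.payoff T p q = fun σ τ => 1 / (T : ℝ) * total P Q g T p q σ τ :=
    funext fun σ => funext fun τ => G.payoff_eq hM hN T hp hq σ τ
  have hopt : IsMaxMin (G.nonRevealing₁ p) (G.nonRevealing₂ q) (G.payoff T p q) (1 / (T : ℝ) * v) ∧
      IsMinMax (G.nonRevealing₁ p) (G.nonRevealing₂ q) (G.payoff T p q) (1 / (T : ℝ) * v) := by
    rw [hpay, G.nonRevealing₁_eq hM hN hp, G.nonRevealing₂_eq hM hN hq]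
    refine isMaxMin_and_isMinMax (fun σ _ => ?_) (fun τ _ => ?_) ?_ ?_
    · obtain ⟨τ, hτ, h⟩ := (Q.isCompact_nonRevealing q).exists_isMinOn
        ⟨_, Q.uniformStrategy_mem hq⟩
        (f := fun τ => total P Q g T p q σ τ)
        (hcont.comp (continuous_const.prodMk continuous_id)).continuousOn
      exact ⟨τ, hτ, fun τ' hτ' => mul_le_mul_of_nonneg_left (h hτ') hT⟩
    · obtain ⟨σ, hσ, h⟩ := (P.isCompact_nonRevealing p).exists_isMaxOn
        ⟨_, P.uniformStrategy_mem hp⟩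
        (f := fun σ => total P Q g T p q σ τ)
        (hcont.comp (continuous_id.prodMk continuous_const)).continuousOn
      exact ⟨σ, hσ, fun σ' hσ' => mul_le_mul_of_nonneg_left (h hσ') hT⟩
    · obtain ⟨σ, hσ, h⟩ := hv
      exact ⟨σ, hσ, fun τ hτ => mul_le_mul_of_nonneg_left (h τ hτ) hT⟩
    · obtain ⟨τ, hτ, h⟩ := hv'
      exact ⟨τ, hτ, fun σ hσ => mul_le_mul_of_nonneg_left (h σ hσ) hT⟩
  have hval : G.nrValue T p q = 1 / (T : ℝ) * v := iSup_iInf_eq hopt.1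
  refine ⟨hval ▸ hopt, ?_⟩
  -- For `T = 0` the total payoff and the claimed bound are both 0, so any non-revealing strategies
  -- work.
  rcases Nat.eq_zero_or_pos T with rfl | hpos
  · exact ⟨⟨_, P.uniformStrategy_mem hp, by simp [total]⟩,
      ⟨_, Q.uniformStrategy_mem hq, by simp [total]⟩⟩
  · have h₁ : (T : ℝ) * G.nrValue T p q = v := by
      rw [hval, one_div, mul_inv_cancel_left₀ (by positivity)]
    rw [h₁]
    exact ⟨hv, hv'⟩

end MarkovGame

/-! ### Assembly of the proposition -/

open MarkovGames in
theorem convex_fiber {S : Type*} [Fintype S] (B : Matrix S S ℝ) (r : S → ℝ) :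
    Convex ℝ (fiber B r) := by
  rintro p₁ ⟨h₁, h₁'⟩ p₂ ⟨h₂, h₂'⟩ a b ha hb hab
  refine ⟨convex_stdSimplex ℝ S h₁ h₂ ha hb hab, ?_⟩
  rw [Matrix.add_vecMul, Matrix.smul_vecMul, Matrix.smul_vecMul, h₁', h₂', ← add_smul, hab,
    one_smul]

theorem mainTheorem5 {K L I J : Type*} [Fintype K] [Fintype L] [Fintype I] [Fintype J]
    [DecidableEq K] [DecidableEq L] [DecidableEq I] [DecidableEq J]
    [Nonempty K] [Nonempty L] [Nonempty I] [Nonempty J]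
    (G : MarkovGame K L I J)
    (hMrec : IsRecurrent G.M) (hMaper : IsAperiodic G.M)
    (hNrec : IsRecurrent G.N) (hNaper : IsAperiodic G.N) :
    (∀ T : ℕ, 1 ≤ T → ∀ p ∈ stdSimplex ℝ K, ∀ q ∈ stdSimplex ℝ L,
      IsMaxMin (G.nonRevealing₁ p) (G.nonRevealing₂ q) (G.payoff T p q) (G.nrValue T p q) ∧
      IsMinMax (G.nonRevealing₁ p) (G.nonRevealing₂ q) (G.payoff T p q) (G.nrValue T p q)) ∧
    (∀ T : ℕ, 1 ≤ T → ∀ q ∈ stdSimplex ℝ L, ∀ pstar ∈ invariantProbs G.M,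
      ConcaveOn ℝ (fiber G.B pstar) (fun p => G.nrValue T p q)) ∧
    (∀ T : ℕ, 1 ≤ T → ∀ p ∈ stdSimplex ℝ K, ∀ qstar ∈ invariantProbs G.N,
      ConvexOn ℝ (fiber G.C qstar) (fun q => G.nrValue T p q)) ∧
    (∀ T : ℕ, ∀ p ∈ stdSimplex ℝ K, ∀ q ∈ stdSimplex ℝ L,
      IsMaxMin (NR G.B p) (NR G.C q) (G.shapley T (G.nrValue T) p q)
        (((T : ℝ) + 1) * G.nrValue (T + 1) p q) ∧
      IsMinMax (NR G.B p) (NR G.C q) (G.shapley T (G.nrValue T) p q)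
        (((T : ℝ) + 1) * G.nrValue (T + 1) p q)) := by
  have hM : G.M * G.B = G.B := mul_limitMatrix G.M_mem hMrec hMaper
  have hN : G.N * G.C = G.C := mul_limitMatrix G.N_mem hNrec hNaper
  refine ⟨fun T _ p hp q hq => (G.value_spec hM hN T hp hq).1, fun T hT q hq pstar _ => ?_,
    fun T hT p hp qstar _ => ?_, fun T p hp q hq => ?_⟩
  · have hT' : (0 : ℝ) < T := by exact_mod_cast hT
    refine ⟨convex_fiber _ _, fun p₁ h₁ p₂ h₂ a b ha hb hab => ?_⟩
    have h := Guarantees.concave h₁.1.1 h₂.1.1 (G.value_spec hM hN T h₁.1 hq).2.1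
      (G.value_spec hM hN T h₂.1 hq).2.1 (h₁.2.trans h₂.2.symm) ha hb hab
    -- What is guaranteed by splitting cannot exceed what the second player defends at the convex
    -- combination.
    have hle := h.le
      (G.value_spec hM hN T (convex_stdSimplex ℝ K h₁.1 h₂.1 ha hb hab) hq).2.2
    refine le_of_mul_le_mul_left (le_of_eq_of_le ?_ hle) hT'
    simp only [smul_eq_mul]
    ring
  · have hT' : (0 : ℝ) < T := by exact_mod_cast hT
    refine ⟨convex_fiber _ _, fun q₁ h₁ q₂ h₂ a b ha hb hab => ?_⟩
    have h := Defends.convex h₁.1.1 h₂.1.1 (G.value_spec hM hN T hp h₁.1).2.2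
      (G.value_spec hM hN T hp h₂.1).2.2 (h₁.2.trans h₂.2.symm) ha hb hab
    have hle := Guarantees.le
      (G.value_spec hM hN T hp (convex_stdSimplex ℝ L h₁.1 h₂.1 ha hb hab)).2.1 h
    refine le_of_mul_le_mul_left (hle.trans_eq ?_) hT'
    simp only [smul_eq_mul]
    ring
  · have hw : ∀ p ∈ stdSimplex ℝ K, ∀ q ∈ stdSimplex ℝ L,
        Guarantees (G.side₁ hM) (G.side₂ hN) (fun k l h => G.g k l h.1 h.2) T p q
          (T * G.nrValue T p q) := fun p hp q hq => (G.value_spec hM hN T hp hq).2.1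
    have hw' : ∀ p ∈ stdSimplex ℝ K, ∀ q ∈ stdSimplex ℝ L,
        Defends (G.side₁ hM) (G.side₂ hN) (fun k l h => G.g k l h.1 h.2) T p q
          (T * G.nrValue T p q) := fun p hp q hq => (G.value_spec hM hN T hp hq).2.2
    have hv := (G.value_spec hM hN (T + 1) hp hq).2
    rw [Nat.cast_add_one] at hv
    have hs : G.shapley T (G.nrValue T) p q = _ :=
      funext fun x => funext fun y => G.shapley_eq_stageValue hM hN T (G.nrValue T) p q x y
    rw [hs]
    -- The saddle point comes from optimal strategies of the `T + 1` stage game, the continuation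
    -- value being `T` times `nrValue T`.
    exact isMaxMin_and_isMinMax
      (fun x hx => exists_min_stageValue hw hw' hp hq hx)
      (fun y hy => exists_max_stageValue hw hw' hp hq hy)
      (exists_forall_le_stageValue hw' hp hq hv.1) (exists_forall_stageValue_le hw hp hq hv.2)
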